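/- Let $\mathbb{HP}^1$ be the left quaternionic projective line, identified with $S^4$, and let $\pi:\mathbb{CP}^3\to\mathbb{HP}^1\simeq S^4$, $\pi[z_0,z_1,z_2,z_3]=[z_0+z_1j,\;z_2+z_3j]$, be the twistor fibration; its fibres are called twistor lines. Let $d\ge 1$ and let $X=\{f=0\}\subset\mathbb{CP}^3$ be any surface of degree $d$, where $f\in\mathbb{C}[z_0,z_1,z_2,z_3]$ is a nonzero homogeneous polynomial of degree $d$ (not necessarily irreducible or square-free). Its twistor discriminant locus is $$\mathrm{Disc}(X)=\{q\in S^4 : |\pi^{-1}(q)\cap X|\neq d\},$$ where $\pi^{-1}(q)\cap X$ is taken as a set of points. Then $\mathrm{Disc}(X)$ is a finite set if and only if either $d=1$, or $d>1$ and $X$ is the union of $d$ distinct planes $H_1,\dots,H_d$ all containing the same twistor line $L$. In all these cases $\mathrm{Disc}(X)$ is a single point. -/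

import Mathlib

open scoped Quaternion LinearAlgebra.Projectivization

namespace Twistor

/-- The complex projective space `ℂℙ³`. -/
abbrev CP3 : Type := ℙ ℂ (Fin 4 → ℂ)

/-- The left quaternionic projective line `ℍℙ¹` (nonzero vectors of `ℍ²` modulo left multiplication
by nonzero quaternions), which is the standard model of the sphere `S⁴ = ℍ ∪ {∞}` here. -/
abbrev HP1 : Type := ℙ ℍ[ℝ] (Fin 2 → ℍ[ℝ])

/-- The quaternionic unit `j`. -/
def quatJ : ℍ[ℝ] := ⟨0, 0, 1, 0⟩

/-- The identification `ℂ⁴ → ℍ²`, `(z₀, z₁, z₂, z₃) ↦ (z₀ + z₁ j, z₂ + z₃ j)`. -/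
noncomputable def toQuat (z : Fin 4 → ℂ) : Fin 2 → ℍ[ℝ] :=
  ![(z 0 : ℍ[ℝ]) + (z 1 : ℍ[ℝ]) * quatJ, (z 2 : ℍ[ℝ]) + (z 3 : ℍ[ℝ]) * quatJ]

theorem toQuat_smul (t : ℂ) (z : Fin 4 → ℂ) : toQuat (t • z) = (t : ℍ[ℝ]) • toQuat z := by
  funext i
  fin_cases i <;> simp [toQuat, mul_add, mul_assoc]

theorem toQuat_ne_zero {z : Fin 4 → ℂ} (hz : z ≠ 0) : toQuat z ≠ 0 := by
  intro h
  apply hz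
  have h0 := congrFun h 0
  have h1 := congrFun h 1
  have hJ : quatJ.re = 0 ∧ quatJ.imI = 0 ∧ quatJ.imJ = 1 ∧ quatJ.imK = 0 := ⟨rfl, rfl, rfl, rfl⟩
  simp [toQuat, hJ, Quaternion.ext_iff, Quaternion.re_mul, Quaternion.imI_mul,
    Quaternion.imJ_mul, Quaternion.imK_mul] at h0 h1
  funext i
  fin_cases i <;> apply Complex.ext <;> simp [h0, h1]

/-- The twistor fibration `π : ℂℙ³ → ℍℙ¹ ≃ S⁴`,
`π [z₀, z₁, z₂, z₃] = [z₀ + z₁ j, z₂ + z₃ j]`. -/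
noncomputable def twistorProj : CP3 → HP1 :=
  Projectivization.lift
    (fun z => Projectivization.mk ℍ[ℝ] (toQuat z.1) (toQuat_ne_zero z.2))
    (by
      rintro ⟨a, ha⟩ ⟨b, hb⟩ t h
      rw [Projectivization.mk_eq_mk_iff']
      exact ⟨(t : ℍ[ℝ]), (toQuat_smul t b).symm.trans (congrArg toQuat h.symm)⟩)

/-- Twistor lines are the fibres of `π`. -/
def IsTwistorLine (L : Set CP3) : Prop := ∃ q : HP1, L = twistorProj ⁻¹' {q}

/-- The zero locus `{f = 0} ⊆ ℂℙ³`, for a homogeneous polynomial `f`. -/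
def zeroLocus (f : MvPolynomial (Fin 4) ℂ) : Set CP3 := {p | MvPolynomial.eval p.rep f = 0}

/-- Membership in the zero locus of a homogeneous polynomial can be tested on any representative. -/
theorem mk_mem_zeroLocus_iff {f : MvPolynomial (Fin 4) ℂ} {d : ℕ} (hf : f.IsHomogeneous d)
    (v : Fin 4 → ℂ) (hv : v ≠ 0) :
    Projectivization.mk ℂ v hv ∈ zeroLocus f ↔ MvPolynomial.eval v f = 0 := by
  obtain ⟨a, ha⟩ := Projectivization.exists_smul_eq_mk_rep ℂ v hv
  have key : MvPolynomial.eval ((a : ℂ) • v) f = (a : ℂ) ^ d * MvPolynomial.eval v f := by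
    rw [MvPolynomial.eval_eq, MvPolynomial.eval_eq, Finset.mul_sum]
    refine Finset.sum_congr rfl fun m hm => ?_
    have hd : ∑ i, m i = d := by
      have := hf (MvPolynomial.mem_support_iff.mp hm)
      rw [Finsupp.weight_apply, Finsupp.sum_fintype _ _ (by simp)] at this
      simpa using this
    have hs : ∑ i ∈ m.support, m i = d := by
      rw [← hd]
      exact Finset.sum_subset (Finset.subset_univ _) (by simp)
    simp only [Pi.smul_apply, smul_eq_mul, mul_pow, Finset.prod_mul_distrib,
      Finset.prod_pow_eq_pow_sum, hs]
    ring
  have h2 : (Projectivization.mk ℂ v hv).rep = (a : ℂ) • v := ha.symm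
  simp [zeroLocus, h2, key]

/-- Planes in `ℂℙ³`: zero loci of nonzero linear forms. -/
def IsPlane (H : Set CP3) : Prop :=
  ∃ l : MvPolynomial (Fin 4) ℂ, l ≠ 0 ∧ l.IsHomogeneous 1 ∧ H = zeroLocus l

/-- The twistor discriminant locus of the surface `X` of degree `d`: the points `q` such that
`π⁻¹(q) ∩ X` does not have exactly `d` points. A fibre contained in `X` has infinitely many points,
hence the `ℕ∞`-valued cardinality. -/
def Disc (d : ℕ) (X : Set CP3) : Set HP1 :=
  {q | (twistorProj ⁻¹' {q} ∩ X).encard ≠ d}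

end Twistor

/-! Left multiplication by `j` becomes the antilinear map `jMap`, and the fibre through `z` is the
projective line of `span {z, jMap z}`. A point is `Good` when its fibre meets `X` in exactly `d`
points; the intersections are then simple, so over a simply connected family of good fibres they
form a trivial covering (`isCoveringMap_rootSpace`, `exists_section`).

Let `2 ≤ d` and let the discriminant be finite. The tangent plane at a point `p` of `X` on a good
fibre contains exactly one twistor line. The key fact is that this line lies over the discriminant
(`not_good_of_tangent`). Suppose that it does not. Distinct points of the plane off the twistor line
have distinct images, so only finitely many of them are bad, and a general line of the plane through
`p` avoids the discriminant. This line is tangent to `X`, hence meets it in fewer than `d` points.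
Over the 2-sphere of fibres met by the line, some sheet of the covering therefore avoids the line.
The vertical derivative of `f` along this sheet never vanishes, but its winding number around the
point at infinity is `2 - d`; hence `d = 2`. For a quadric, the tangent plane contains the lines
from `p` to the two points of `X` on its twistor line. Transport along a triangle of fibres
identifies these two points, which is absurd.

So the twistor line of the tangent plane belongs to a finite set; by continuity it is locally
constant along `X`. Its directions are then tangent to `X` at all points near `p`, and integrating
them puts the whole tangent plane inside `X` (`eval_eq_zero_of_polyDeriv_eq_zero`). The `d` points
on one good fibre yield `d` planes. Two of them meet in a line along which no fibre is good, and
finiteness forces this line to be a twistor line. A degree count shows that `X` has no other points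
(`exists_planes`).

Conversely, planes through a common twistor line meet any other fibre in one point each, and
distinct planes in distinct points (`disc_eq_singleton`). -/

namespace Twistor

open Filter Topology

/-! ### The antilinear structure map and the fibres of the twistor fibration -/

/-- Left multiplication by `j`, transported to `ℂ⁴`. -/
noncomputable def jMap (z : Fin 4 → ℂ) : Fin 4 → ℂ :=
  ![-star (z 1), star (z 0), -star (z 3), star (z 2)]

theorem jMap_add (z w : Fin 4 → ℂ) : jMap (z + w) = jMap z + jMap w := by
  funext i
  fin_cases i <;> simp [jMap] <;> ring

theorem jMap_smul (t : ℂ) (z : Fin 4 → ℂ) : jMap (t • z) = star t • jMap z := by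
  funext i
  fin_cases i <;> simp [jMap]

theorem jMap_jMap (z : Fin 4 → ℂ) : jMap (jMap z) = -z := by
  funext i
  fin_cases i <;> simp [jMap]

theorem jMap_zero : jMap 0 = 0 := by
  funext i
  fin_cases i <;> simp [jMap]

theorem continuous_jMap : Continuous jMap := by
  refine continuous_pi fun i => ?_
  fin_cases i <;> simp [jMap] <;> fun_prop

theorem jMap_ne_zero {z : Fin 4 → ℂ} (hz : z ≠ 0) : jMap z ≠ 0 := by
  intro h
  have := jMap_jMap z
  rw [h, jMap_zero] at this
  exact hz (by simpa using this.symm)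

/-- The vectors `z` and `jMap z` are orthogonal of equal norm, so Hermitian products read off
coordinates on a fibre, continuously in `z`. -/
theorem star_dotProduct_jMap (z : Fin 4 → ℂ) : star z ⬝ᵥ jMap z = 0 := by
  simp [dotProduct, Fin.sum_univ_four, jMap]
  ring

theorem star_jMap_dotProduct (z : Fin 4 → ℂ) : star (jMap z) ⬝ᵥ z = 0 := by
  simp [dotProduct, Fin.sum_univ_four, jMap]
  ring

theorem star_jMap_dotProduct_jMap (z : Fin 4 → ℂ) : star (jMap z) ⬝ᵥ jMap z = star z ⬝ᵥ z := by
  simp [dotProduct, Fin.sum_univ_four, jMap]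
  ring

open scoped ComplexOrder in
theorem star_dotProduct_self_ne_zero {z : Fin 4 → ℂ} (hz : z ≠ 0) : star z ⬝ᵥ z ≠ 0 := by
  rwa [Ne, dotProduct_star_self_eq_zero]

theorem dotProduct_span_jMap_left (z : Fin 4 → ℂ) (u v : ℂ) :
    star z ⬝ᵥ (u • z + v • jMap z) = u * (star z ⬝ᵥ z) := by
  rw [dotProduct_add, dotProduct_smul, dotProduct_smul, star_dotProduct_jMap]
  simp

theorem dotProduct_span_jMap_right (z : Fin 4 → ℂ) (u v : ℂ) :
    star (jMap z) ⬝ᵥ (u • z + v • jMap z) = v * (star z ⬝ᵥ z) := by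
  rw [dotProduct_add, dotProduct_smul, dotProduct_smul, star_jMap_dotProduct,
    star_jMap_dotProduct_jMap]
  simp

theorem span_jMap_eq_zero {z : Fin 4 → ℂ} (hz : z ≠ 0) {u v : ℂ} (h : u • z + v • jMap z = 0) :
    u = 0 ∧ v = 0 := by
  have h1 := dotProduct_span_jMap_left z u v
  have h2 := dotProduct_span_jMap_right z u v
  rw [h, dotProduct_zero] at h1 h2
  have := star_dotProduct_self_ne_zero hz
  exact ⟨by simpa [this] using h1.symm, by simpa [this] using h2.symm⟩

theorem jMap_span (z : Fin 4 → ℂ) (u v : ℂ) :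
    jMap (u • z + v • jMap z) = (-star v) • z + star u • jMap z := by
  rw [jMap_add, jMap_smul, jMap_smul, jMap_jMap]
  module

/-- Two vectors of `ℂ⁴` lie over the same point of `ℍℙ¹`. -/
def SameFibre (z w : Fin 4 → ℂ) : Prop := ∃ u v : ℂ, w = u • z + v • jMap z

/-- Every quaternion is `u + v j`, so the complex span of `z` and `jMap z` is the whole left
quaternionic line of `z`. -/
theorem toQuat_span (z : Fin 4 → ℂ) (u v : ℂ) :
    toQuat (u • z + v • jMap z) = ((u : ℍ[ℝ]) + (v : ℍ[ℝ]) * quatJ) • toQuat z := by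
  have hJ : quatJ.re = 0 ∧ quatJ.imI = 0 ∧ quatJ.imJ = 1 ∧ quatJ.imK = 0 := ⟨rfl, rfl, rfl, rfl⟩
  funext i
  fin_cases i <;> ext <;>
    simp [toQuat, jMap, hJ, Quaternion.re_mul, Quaternion.imI_mul,
      Quaternion.imJ_mul, Quaternion.imK_mul] <;> ring

theorem quat_eq (q : ℍ[ℝ]) :
    q = (((⟨q.re, q.imI⟩ : ℂ) : ℍ[ℝ]) + ((⟨q.imJ, q.imK⟩ : ℂ) : ℍ[ℝ]) * quatJ) := by
  have hJ : quatJ.re = 0 ∧ quatJ.imI = 0 ∧ quatJ.imJ = 1 ∧ quatJ.imK = 0 := ⟨rfl, rfl, rfl, rfl⟩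
  ext <;> simp [hJ, Quaternion.re_mul, Quaternion.imI_mul, Quaternion.imJ_mul, Quaternion.imK_mul]

theorem toQuat_sub (z w : Fin 4 → ℂ) : toQuat (z - w) = toQuat z - toQuat w := by
  funext i
  have hJ : quatJ.re = 0 ∧ quatJ.imI = 0 ∧ quatJ.imJ = 1 ∧ quatJ.imK = 0 := ⟨rfl, rfl, rfl, rfl⟩
  fin_cases i <;> ext <;>
    simp [toQuat, hJ, Quaternion.re_mul, Quaternion.imI_mul,
      Quaternion.imJ_mul, Quaternion.imK_mul]

theorem toQuat_injective : Function.Injective toQuat := by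
  intro z w h
  by_contra hne
  exact toQuat_ne_zero (sub_ne_zero.2 hne) (by rw [toQuat_sub, h, sub_self])

theorem toQuat_surjective : Function.Surjective toQuat := by
  intro x
  refine ⟨![⟨(x 0).re, (x 0).imI⟩, ⟨(x 0).imJ, (x 0).imK⟩, ⟨(x 1).re, (x 1).imI⟩,
    ⟨(x 1).imJ, (x 1).imK⟩], ?_⟩
  funext i
  fin_cases i
  · exact (quat_eq (x 0)).symm
  · exact (quat_eq (x 1)).symm

theorem twistorProj_mk {z : Fin 4 → ℂ} (hz : z ≠ 0) :
    twistorProj (Projectivization.mk ℂ z hz) =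
      Projectivization.mk ℍ[ℝ] (toQuat z) (toQuat_ne_zero hz) := rfl

theorem twistorProj_mk_eq_iff {z w : Fin 4 → ℂ} (hz : z ≠ 0) (hw : w ≠ 0) :
    twistorProj (Projectivization.mk ℂ w hw) = twistorProj (Projectivization.mk ℂ z hz) ↔
      SameFibre z w := by
  rw [twistorProj_mk, twistorProj_mk, Projectivization.mk_eq_mk_iff']
  constructor
  · rintro ⟨q, hq⟩
    refine ⟨⟨q.re, q.imI⟩, ⟨q.imJ, q.imK⟩, toQuat_injective ?_⟩
    rw [toQuat_span, ← quat_eq, hq]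
  · rintro ⟨u, v, rfl⟩
    exact ⟨_, (toQuat_span z u v).symm⟩

theorem exists_twistorProj_mk (q : HP1) :
    ∃ (z : Fin 4 → ℂ) (hz : z ≠ 0), twistorProj (Projectivization.mk ℂ z hz) = q := by
  induction q using Projectivization.ind with
  | h x hx =>
    obtain ⟨z, rfl⟩ := toQuat_surjective x
    have hz : z ≠ 0 := by
      rintro rfl
      apply hx
      funext i
      fin_cases i <;> simp [toQuat]
    exact ⟨z, hz, rfl⟩

theorem SameFibre.symm {z w : Fin 4 → ℂ} (hz : z ≠ 0) (hw : w ≠ 0) (h : SameFibre z w) :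
    SameFibre w z :=
  (twistorProj_mk_eq_iff hw hz).1 ((twistorProj_mk_eq_iff hz hw).2 h).symm

theorem SameFibre.trans {x y z : Fin 4 → ℂ} (hx : x ≠ 0) (hy : y ≠ 0) (hz : z ≠ 0)
    (h : SameFibre x y) (h' : SameFibre y z) : SameFibre x z :=
  (twistorProj_mk_eq_iff hx hz).1
    (((twistorProj_mk_eq_iff hy hz).2 h').trans ((twistorProj_mk_eq_iff hx hy).2 h))

/-- Different fibres come from quaternionic lines that meet only in zero, so their complex planes
are complementary in `ℂ⁴`. -/
theorem linearIndependent_of_not_sameFibre {z w : Fin 4 → ℂ} (hz : z ≠ 0) (hw : w ≠ 0)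
    (h : ¬ SameFibre z w) : LinearIndependent ℂ ![z, jMap z, w, jMap w] := by
  rw [Fintype.linearIndependent_iff]
  intro g hg
  simp only [Fin.sum_univ_four, Matrix.cons_val] at hg
  have key : g 2 • w + g 3 • jMap w = 0 := by
    by_contra hne
    have h1 : SameFibre w (g 2 • w + g 3 • jMap w) := ⟨_, _, rfl⟩
    have h2 : SameFibre z (g 2 • w + g 3 • jMap w) := by
      refine ⟨-g 0, -g 1, ?_⟩
      linear_combination (norm := module) hg
    exact h (h2.trans hz hne hw (h1.symm hw hne))
  have h01 : g 0 • z + g 1 • jMap z = 0 := by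
    linear_combination (norm := module) hg - key
  have a := span_jMap_eq_zero hz h01
  have b := span_jMap_eq_zero hw key
  intro i
  fin_cases i
  exacts [a.1, a.2, b.1, b.2]

/-- A nonzero linear form vanishes on at most one twistor line. -/
theorem sameFibre_of_apply_eq_zero {φ : (Fin 4 → ℂ) →ₗ[ℂ] ℂ} (hφ : φ ≠ 0) {z w : Fin 4 → ℂ}
    (hz : z ≠ 0) (hw : w ≠ 0) (h1 : φ z = 0) (h2 : φ (jMap z) = 0) (h3 : φ w = 0)
    (h4 : φ (jMap w) = 0) : SameFibre z w := by
  by_contra h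
  have li := linearIndependent_of_not_sameFibre hz hw h
  apply hφ
  let b := basisOfLinearIndependentOfCardEqFinrank li (by simp)
  apply b.ext
  intro i
  fin_cases i <;> simp [b, h1, h2, h3, h4]

/-- A linear form vanishes on some twistor line. -/
theorem exists_apply_eq_zero_and_apply_jMap_eq_zero (φ : (Fin 4 → ℂ) →ₗ[ℂ] ℂ) :
    ∃ e : Fin 4 → ℂ, e ≠ 0 ∧ φ e = 0 ∧ φ (jMap e) = 0 := by
  -- Conjugation makes `φ ∘ jMap` linear; two linear forms on `ℂ⁴` have a common nontrivial zero.
  let ψ : (Fin 4 → ℂ) →ₗ[ℂ] ℂ :=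
    { toFun := fun z => star (φ (jMap z))
      map_add' := fun z w => by rw [jMap_add, map_add, star_add]
      map_smul' := fun t z => by rw [jMap_smul, map_smul]; simp }
  have h := LinearMap.ker_ne_bot_of_finrank_lt (f := φ.prod ψ) (by simp)
  obtain ⟨e, he, hne⟩ := (Submodule.ne_bot_iff _).1 h
  rw [LinearMap.mem_ker, LinearMap.prod_apply] at he
  have h1 : φ e = 0 := congrArg Prod.fst he
  have h2 : star (φ (jMap e)) = 0 := congrArg Prod.snd he
  exact ⟨e, hne, h1, by simpa using h2⟩

/-! ### Homogeneous polynomials along lines -/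

/-- The univariate polynomial `t ↦ f (w + t x)`. -/
noncomputable def linePoly (f : MvPolynomial (Fin 4) ℂ) (w x : Fin 4 → ℂ) : Polynomial ℂ :=
  MvPolynomial.aeval (fun i => Polynomial.C (w i) + Polynomial.C (x i) * Polynomial.X) f

theorem eval_linePoly (f : MvPolynomial (Fin 4) ℂ) (w x : Fin 4 → ℂ) (t : ℂ) :
    (linePoly f w x).eval t = MvPolynomial.eval (w + t • x) f := by
  rw [linePoly, ← Polynomial.coe_aeval_eq_eval, MvPolynomial.comp_aeval_apply,
    ← MvPolynomial.coe_aeval_eq_eval]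
  have : (fun i => Polynomial.aeval t (Polynomial.C (w i) + Polynomial.C (x i) * Polynomial.X)) =
      w + t • x := by
    funext i
    rw [Polynomial.coe_aeval_eq_eval, Polynomial.eval_add, Polynomial.eval_mul, Polynomial.eval_C,
      Polynomial.eval_C, Polynomial.eval_X, Pi.add_apply, Pi.smul_apply, smul_eq_mul, mul_comm]
  rw [this]
  rfl

theorem natDegree_linePoly_le {f : MvPolynomial (Fin 4) ℂ} {d : ℕ} (hf : f.IsHomogeneous d)
    (w x : Fin 4 → ℂ) : (linePoly f w x).natDegree ≤ d := by
  have := MvPolynomial.aeval_natDegree_le f hf.totalDegree_le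
    (fun i => Polynomial.C (w i) + Polynomial.C (x i) * Polynomial.X) (n := 1)
    (fun i => by compute_degree)
  simpa [linePoly] using this

theorem eval_smul_of_isHomogeneous {f : MvPolynomial (Fin 4) ℂ} {d : ℕ} (hf : f.IsHomogeneous d)
    (t : ℂ) (z : Fin 4 → ℂ) : MvPolynomial.eval (t • z) f = t ^ d * MvPolynomial.eval z f := by
  rw [MvPolynomial.eval_eq, MvPolynomial.eval_eq, Finset.mul_sum]
  refine Finset.sum_congr rfl fun m hm => ?_
  have hs : ∑ i ∈ m.support, m i = d := by
    rw [← hf (MvPolynomial.mem_support_iff.mp hm), Finsupp.weight_apply, Finsupp.sum]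
    simp
  simp only [Pi.smul_apply, smul_eq_mul, mul_pow, Finset.prod_mul_distrib,
    Finset.prod_pow_eq_pow_sum, hs]
  ring

/-- Reversing the coefficients exchanges `w` and `x`, so the top coefficient is the value at the
point at infinity `x` of the line. A root there lowers the degree. -/
theorem coeff_linePoly {f : MvPolynomial (Fin 4) ℂ} {d : ℕ} (hf : f.IsHomogeneous d)
    (w x : Fin 4 → ℂ) : (linePoly f w x).coeff d = MvPolynomial.eval x f := by
  have h : Polynomial.reflect d (linePoly f w x) = linePoly f x w := by
    refine Polynomial.eq_of_infinite_eval_eq _ _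
      ((Set.finite_singleton (0 : ℂ)).infinite_compl.mono ?_)
    intro t ht
    have ht : t ≠ 0 := ht
    have : Invertible t⁻¹ := invertibleOfNonzero (inv_ne_zero ht)
    have h1 := Polynomial.eval₂_reflect_mul_pow (RingHom.id ℂ) t⁻¹ d (linePoly f w x)
      (natDegree_linePoly_le hf w x)
    rw [invOf_eq_inv, inv_inv, ← Polynomial.eval, ← Polynomial.eval, eval_linePoly] at h1
    show Polynomial.eval t _ = Polynomial.eval t _
    rw [eval_linePoly, show x + t • w = t • (w + t⁻¹ • x) by
      rw [smul_add, smul_smul, mul_inv_cancel₀ ht, one_smul, add_comm],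
      eval_smul_of_isHomogeneous hf, ← h1, inv_pow, mul_comm, mul_assoc,
      inv_mul_cancel₀ (pow_ne_zero _ ht), mul_one]
  have h0 : (linePoly f x w).coeff 0 = MvPolynomial.eval x f := by
    rw [Polynomial.coeff_zero_eq_eval_zero, eval_linePoly, zero_smul, add_zero]
  rw [← h0, ← h, Polynomial.coeff_reflect, Polynomial.revAt_zero]

theorem contDiff_eval (f : MvPolynomial (Fin 4) ℂ) :
    ContDiff ℂ ⊤ (fun z : Fin 4 → ℂ => MvPolynomial.eval z f) :=
  (AnalyticOnNhd.eval_mvPolynomial f).contDiff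

/-- The differential of a polynomial function. -/
noncomputable def polyDeriv (f : MvPolynomial (Fin 4) ℂ) (z : Fin 4 → ℂ) : (Fin 4 → ℂ) →L[ℂ] ℂ :=
  fderiv ℂ (fun z : Fin 4 → ℂ => MvPolynomial.eval z f) z

theorem hasFDerivAt_eval (f : MvPolynomial (Fin 4) ℂ) (z : Fin 4 → ℂ) :
    HasFDerivAt (fun z : Fin 4 → ℂ => MvPolynomial.eval z f) (polyDeriv f z) z :=
  ((contDiff_eval f).differentiable (by simp) z).hasFDerivAt

theorem continuous_polyDeriv (f : MvPolynomial (Fin 4) ℂ) : Continuous (polyDeriv f) :=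
  (contDiff_eval f).continuous_fderiv (by simp)

theorem hasDerivAt_eval_line (f : MvPolynomial (Fin 4) ℂ) (w x : Fin 4 → ℂ) (t : ℂ) :
    HasDerivAt (fun t : ℂ => MvPolynomial.eval (w + t • x) f) (polyDeriv f (w + t • x) x) t := by
  have h : HasDerivAt (fun t : ℂ => w + t • x) x t := by
    simpa using ((hasDerivAt_id t).smul_const x).const_add w
  exact (hasFDerivAt_eval f (w + t • x)).comp_hasDerivAt t h

theorem eval_derivative_linePoly (f : MvPolynomial (Fin 4) ℂ) (w x : Fin 4 → ℂ) (t : ℂ) :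
    (linePoly f w x).derivative.eval t = polyDeriv f (w + t • x) x := by
  have h := (linePoly f w x).hasDerivAt t
  simp only [eval_linePoly] at h
  exact h.unique (hasDerivAt_eval_line f w x t)

/-- The factor `t` on the left avoids the exponent `d - 1`. -/
theorem polyDeriv_smul {f : MvPolynomial (Fin 4) ℂ} {d : ℕ} (hf : f.IsHomogeneous d)
    (t : ℂ) (z x : Fin 4 → ℂ) : t * polyDeriv f (t • z) x = t ^ d * polyDeriv f z x := by
  have h1 := hasDerivAt_eval_line f (t • z) (t • x) 0
  have h2 := (hasDerivAt_eval_line f z x 0).const_mul (t ^ d)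
  have : (fun s : ℂ => MvPolynomial.eval (t • z + s • t • x) f) =
      fun s => t ^ d * MvPolynomial.eval (z + s • x) f := by
    funext s
    rw [← eval_smul_of_isHomogeneous hf, smul_add, smul_comm]
  rw [this] at h1
  simpa using h1.unique h2

/-- Euler's identity. -/
theorem polyDeriv_self {f : MvPolynomial (Fin 4) ℂ} {d : ℕ} (hf : f.IsHomogeneous d)
    (z : Fin 4 → ℂ) : polyDeriv f z z = d * MvPolynomial.eval z f := by
  have h1 := hasDerivAt_eval_line f 0 z 1
  have h2 := ((hasDerivAt_id (1 : ℂ)).pow d).mul_const (MvPolynomial.eval z f)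
  simp only [zero_add, one_smul, eval_smul_of_isHomogeneous hf] at h1
  simpa using h1.unique h2

theorem card_roots_lt_of_double_root {P : Polynomial ℂ} (hP : P ≠ 0) (h0 : P.eval 0 = 0)
    (h1 : P.derivative.eval 0 = 0) : P.roots.toFinset.card < P.natDegree := by
  refine lt_of_lt_of_le (lt_of_le_of_ne (Multiset.toFinset_card_le _) fun h => ?_) P.card_roots'
  have hn := Multiset.toFinset_card_eq_card_iff_nodup.1 h
  have h2 := (Polynomial.one_lt_rootMultiplicity_iff_isRoot hP).2 ⟨h0, h1⟩
  rw [← Polynomial.count_roots] at h2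
  have := Multiset.nodup_iff_count_le_one.1 hn 0
  omega

/-! ### Points outside the discriminant -/

/-- `z` is a nonzero vector whose twistor line meets the surface in exactly `d` points. -/
def Good (f : MvPolynomial (Fin 4) ℂ) (d : ℕ) (z : Fin 4 → ℂ) : Prop :=
  ∃ hz : z ≠ 0, twistorProj (Projectivization.mk ℂ z hz) ∉ Disc d (zeroLocus f)

theorem Good.of_sameFibre {f : MvPolynomial (Fin 4) ℂ} {d : ℕ} {z w : Fin 4 → ℂ} (h : Good f d z)
    (hw : w ≠ 0) (hzw : SameFibre z w) : Good f d w :=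
  ⟨hw, by rw [(twistorProj_mk_eq_iff h.1 hw).2 hzw]; exact h.2⟩

theorem Good.encard {f : MvPolynomial (Fin 4) ℂ} {d : ℕ} {z : Fin 4 → ℂ} (h : Good f d z) :
    (twistorProj ⁻¹' {twistorProj (Projectivization.mk ℂ z h.1)} ∩ zeroLocus f).encard = d := by
  by_contra hne
  exact h.2 hne

theorem add_smul_jMap_ne_zero {z : Fin 4 → ℂ} (hz : z ≠ 0) (t : ℂ) : z + t • jMap z ≠ 0 := by
  intro h
  have := (span_jMap_eq_zero hz (u := 1) (v := t) (by rwa [one_smul])).1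
  exact one_ne_zero this

theorem sameFibre_add_smul_jMap (z : Fin 4 → ℂ) (t : ℂ) : SameFibre z (z + t • jMap z) :=
  ⟨1, t, by rw [one_smul]⟩

theorem mk_add_smul_jMap_injective {z : Fin 4 → ℂ} (hz : z ≠ 0) :
    Function.Injective fun t : ℂ =>
      Projectivization.mk ℂ (z + t • jMap z) (add_smul_jMap_ne_zero hz t) := by
  intro t s h
  obtain ⟨a, ha⟩ := (Projectivization.mk_eq_mk_iff' ..).1 h
  have := span_jMap_eq_zero hz (u := a - 1) (v := a * s - t) (by
    linear_combination (norm := module) ha)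
  have ha : a = 1 := by linear_combination this.1
  rw [ha] at this
  linear_combination -this.2

theorem Good.linePoly_ne_zero {f : MvPolynomial (Fin 4) ℂ} {d : ℕ} (hf : f.IsHomogeneous d)
    {z : Fin 4 → ℂ} (h : Good f d z) : linePoly f z (jMap z) ≠ 0 := by
  intro h0
  have hinf :
      (twistorProj ⁻¹' {twistorProj (Projectivization.mk ℂ z h.1)} ∩ zeroLocus f).Infinite := by
    refine (Set.infinite_range_of_injective (mk_add_smul_jMap_injective h.1)).mono ?_
    rintro _ ⟨t, rfl⟩
    refine ⟨(twistorProj_mk_eq_iff _ _).2 (sameFibre_add_smul_jMap z t), ?_⟩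
    rw [mk_mem_zeroLocus_iff hf, ← eval_linePoly, h0, Polynomial.eval_zero]
  have := h.encard
  rw [hinf.encard_eq] at this
  exact ENat.top_ne_natCast d this

/-- A fibre outside the discriminant meets the surface transversally. -/
theorem Good.polyDeriv_jMap_ne_zero {f : MvPolynomial (Fin 4) ℂ} {d : ℕ} (hf : f.IsHomogeneous d)
    {w : Fin 4 → ℂ} (h : Good f d w) (hw : MvPolynomial.eval w f = 0) :
    polyDeriv f w (jMap w) ≠ 0 := by
  classical
  intro hD
  set P := linePoly f w (jMap w) with hPdef
  have hP : P ≠ 0 := h.linePoly_ne_zero hf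
  have hcard : P.roots.toFinset.card < P.natDegree := by
    refine card_roots_lt_of_double_root hP ?_ ?_
    · rw [eval_linePoly, zero_smul, add_zero, hw]
    · rw [eval_derivative_linePoly, zero_smul, add_zero, hD]
  have hdeg : P.natDegree ≤ d := natDegree_linePoly_le hf _ _
  let g : ℂ → CP3 := fun t => Projectivization.mk ℂ (w + t • jMap w) (add_smul_jMap_ne_zero h.1 t)
  -- The affine roots, together with the point at infinity `jMap w` of the fibre when it lies on the
  -- surface.
  let F : Finset CP3 := P.roots.toFinset.image g ∪
    (if MvPolynomial.eval (jMap w) f = 0 then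
      {Projectivization.mk ℂ (jMap w) (jMap_ne_zero h.1)} else ∅)
  have hsub : twistorProj ⁻¹' {twistorProj (Projectivization.mk ℂ w h.1)} ∩ zeroLocus f ⊆ F := by
    rintro x ⟨hx1, hx2⟩
    induction x using Projectivization.ind with
    | h x hx =>
      obtain ⟨u, v, rfl⟩ := (twistorProj_mk_eq_iff h.1 hx).1 hx1
      rw [mk_mem_zeroLocus_iff hf] at hx2
      simp only [F, Finset.coe_union, Finset.coe_image, Set.mem_union, Set.mem_image,
        Finset.mem_coe]
      by_cases hu : u = 0
      · right
        subst hu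
        have hv : v ≠ 0 := by rintro rfl; simp at hx
        rw [zero_smul, zero_add, eval_smul_of_isHomogeneous hf, mul_eq_zero,
          or_iff_right (pow_ne_zero _ hv)] at hx2
        rw [if_pos hx2, Finset.mem_singleton, Projectivization.mk_eq_mk_iff']
        exact ⟨v, by simp⟩
      · left
        have he : u • w + v • jMap w = u • (w + (u⁻¹ * v) • jMap w) := by
          rw [smul_add, smul_smul, mul_inv_cancel_left₀ hu]
        refine ⟨u⁻¹ * v, ?_, ?_⟩
        · rw [Multiset.mem_toFinset, Polynomial.mem_roots hP, Polynomial.IsRoot, eval_linePoly]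
          rw [he, eval_smul_of_isHomogeneous hf, mul_eq_zero,
            or_iff_right (pow_ne_zero _ hu)] at hx2
          exact hx2
        · rw [Projectivization.mk_eq_mk_iff']
          exact ⟨u⁻¹, by rw [he, inv_smul_smul₀ hu]⟩
  have hF : F.card < d := by
    have h1 : (P.roots.toFinset.image g).card ≤ P.roots.toFinset.card := Finset.card_image_le
    by_cases hj : MvPolynomial.eval (jMap w) f = 0
    · have hlt : P.natDegree ≠ d := by
        intro he
        apply hP
        rw [← Polynomial.leadingCoeff_eq_zero, Polynomial.leadingCoeff, he, hPdef,
          coeff_linePoly hf, hj]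
      have := Finset.card_union_le (P.roots.toFinset.image g)
        {Projectivization.mk ℂ (jMap w) (jMap_ne_zero h.1)}
      simp only [F, if_pos hj]
      rw [Finset.card_singleton] at this
      omega
    · simp only [F, if_neg hj, Finset.union_empty]
      omega
  have hle := Set.encard_le_encard hsub
  rw [h.encard, Set.encard_coe_eq_coe_finsetCard] at hle
  have : d ≤ F.card := by exact_mod_cast hle
  omega

/-- Representatives of the points of the surface on a fibre outside the discriminant. -/
theorem Good.exists_roots {f : MvPolynomial (Fin 4) ℂ} {d : ℕ} (hf : f.IsHomogeneous d)
    {z : Fin 4 → ℂ} (h : Good f d z) : ∃ P : Fin d → Fin 4 → ℂ, (∀ i, P i ≠ 0) ∧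
      (∀ i, SameFibre z (P i)) ∧ (∀ i, MvPolynomial.eval (P i) f = 0) ∧
      (∀ i k, ∀ c : ℂ, P k = c • P i → i = k) ∧
      (∀ w, w ≠ 0 → SameFibre z w → MvPolynomial.eval w f = 0 → ∃ i, ∃ c : ℂ, w = c • P i) := by
  set A := twistorProj ⁻¹' {twistorProj (Projectivization.mk ℂ z h.1)} ∩ zeroLocus f with hA
  have hfin : A.Finite := Set.finite_of_encard_eq_coe h.encard
  have hn : Nat.card A = d := by
    have := h.encard
    rw [← hA, ← hfin.cast_ncard_eq] at this
    exact_mod_cast this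
  have := hfin.to_subtype
  let e : Fin d ≃ A := (finCongr hn.symm).trans (Finite.equivFin A).symm
  have hmk : ∀ x : CP3, Projectivization.mk ℂ x.rep x.rep_nonzero = x := fun x => x.mk_rep
  refine ⟨fun i => (e i).1.rep, fun i => (e i).1.rep_nonzero, fun i => ?_, fun i => (e i).2.2,
    fun i k c hc => ?_, fun w hw hzw hfw => ?_⟩
  · rw [← twistorProj_mk_eq_iff h.1 (e i).1.rep_nonzero, hmk]
    exact (e i).2.1
  · apply e.injective
    apply Subtype.ext
    rw [← hmk (e i).1, ← hmk (e k).1, eq_comm, Projectivization.mk_eq_mk_iff']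
    exact ⟨c, hc.symm⟩
  · have hwA : Projectivization.mk ℂ w hw ∈ A :=
      ⟨(twistorProj_mk_eq_iff h.1 hw).2 hzw, (mk_mem_zeroLocus_iff hf w hw).2 hfw⟩
    obtain ⟨i, hi⟩ := e.surjective ⟨_, hwA⟩
    refine ⟨i, ?_⟩
    have h1 : Projectivization.mk ℂ w hw =
        Projectivization.mk ℂ (e i).1.rep (e i).1.rep_nonzero := by
      rw [hmk, hi]
    obtain ⟨c, hc⟩ := (Projectivization.mk_eq_mk_iff' ..).1 h1
    exact ⟨c, hc.symm⟩

/-- A family of vectors in distinct fibres is good up to finitely many exceptions. -/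
theorem finite_not_good {f : MvPolynomial (Fin 4) ℂ} {d : ℕ} (hS : (Disc d (zeroLocus f)).Finite)
    {T : Type*} (γ : T → Fin 4 → ℂ) (h0 : ∀ t, γ t ≠ 0)
    (hinj : ∀ t s, SameFibre (γ t) (γ s) → t = s) : {t | ¬ Good f d (γ t)}.Finite := by
  have : Function.Injective fun t => twistorProj (Projectivization.mk ℂ (γ t) (h0 t)) :=
    fun t s h => (hinj s t ((twistorProj_mk_eq_iff _ _).1 h)).symm
  refine (hS.preimage this.injOn).subset fun t ht => ?_
  by_contra h
  exact ht ⟨h0 t, h⟩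

/-! ### The Riemann sphere of rank one projections -/

/-- The projective line, embedded as the sphere of orthogonal projections
`!![α, β; conj β, 1 - α]` of rank one of `ℂ²`. -/
abbrev ProjLine : Type := {x : ℝ × ℂ // x.1 ^ 2 + ‖x.2‖ ^ 2 = x.1}

/-- Compactness makes the projection of `rootSpace` onto its base a closed map. -/
instance : CompactSpace ProjLine := by
  refine (isCompact_iff_compactSpace (s := {x : ℝ × ℂ | x.1 ^ 2 + ‖x.2‖ ^ 2 = x.1})).1 ?_
  refine Metric.isCompact_of_isClosed_isBounded ?_ ?_
  · exact isClosed_eq (by fun_prop) (by fun_prop)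
  · refine (Metric.isBounded_closedBall (x := (0 : ℝ × ℂ)) (r := 1)).subset fun x hx => ?_
    have hx : x.1 ^ 2 + ‖x.2‖ ^ 2 = x.1 := hx
    rw [mem_closedBall_zero_iff, Prod.norm_def, max_le_iff, Real.norm_eq_abs, abs_le]
    refine ⟨⟨by nlinarith [norm_nonneg x.2], by nlinarith [norm_nonneg x.2]⟩, ?_⟩
    by_contra h
    nlinarith [sq_nonneg (x.1 - 1), norm_nonneg x.2]

/-- The point `[u : v]` of the projective line. -/
noncomputable def ProjLine.pt (u v : ℂ) : ProjLine :=
  ⟨(‖u‖ ^ 2 / (‖u‖ ^ 2 + ‖v‖ ^ 2), u * star v / ((‖u‖ ^ 2 + ‖v‖ ^ 2 : ℝ) : ℂ)), by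
    -- Division by zero sends `[0 : 0]` to the pair `(0, 0)`, which also satisfies the equation of
    -- the sphere.
    by_cases h : ‖u‖ ^ 2 + ‖v‖ ^ 2 = 0
    · simp [h]
    · rw [norm_div, norm_mul, norm_star, Complex.norm_real, Real.norm_eq_abs, div_pow, div_pow,
        sq_abs]
      field_simp⟩

theorem ProjLine.norm_sq_add_ne_zero {u v : ℂ} (h : u ≠ 0 ∨ v ≠ 0) : ‖u‖ ^ 2 + ‖v‖ ^ 2 ≠ 0 := by
  rcases h with h | h <;> have := norm_pos_iff.2 h <;> positivity

theorem ProjLine.pt_fst (u v : ℂ) : (pt u v).1.1 = ‖u‖ ^ 2 / (‖u‖ ^ 2 + ‖v‖ ^ 2) := rfl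

theorem ProjLine.pt_snd (u v : ℂ) :
    (pt u v).1.2 = u * star v / ((‖u‖ ^ 2 + ‖v‖ ^ 2 : ℝ) : ℂ) := rfl

theorem ProjLine.continuousAt_pt {A : Type*} [TopologicalSpace A] {u v : A → ℂ} {a : A}
    (hu : ContinuousAt u a) (hv : ContinuousAt v a) (h : u a ≠ 0 ∨ v a ≠ 0) :
    ContinuousAt (fun a => pt (u a) (v a)) a := by
  have hn := norm_sq_add_ne_zero h
  refine IsInducing.subtypeVal.continuousAt_iff.2 ?_
  refine ContinuousAt.prodMk ?_ ?_
  · exact ContinuousAt.div (by fun_prop) (by fun_prop) hn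
  · refine ContinuousAt.div (by fun_prop) (by fun_prop) ?_
    exact_mod_cast hn

/-- Away from `[1 : 0]`, the coordinate `s` of `[s : 1]` is a continuous function on the sphere;
`pt_of_fst_ne_zero` gives the other affine chart. -/
theorem ProjLine.pt_of_fst_ne_one (m : ProjLine) (h : m.1.1 ≠ 1) :
    pt (m.1.2 / (1 - m.1.1 : ℝ)) 1 = m := by
  obtain ⟨⟨α, β⟩, hm⟩ := m
  simp only at hm h ⊢
  have h1 : 1 - α ≠ 0 := sub_ne_zero.2 (Ne.symm h)
  have hb : ‖β‖ ^ 2 = α * (1 - α) := by linear_combination hm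
  have hn : ‖β / ((1 - α : ℝ) : ℂ)‖ ^ 2 = α / (1 - α) := by
    rw [norm_div, div_pow, Complex.norm_real, Real.norm_eq_abs, sq_abs, hb]
    field_simp
  have hs : α / (1 - α) + 1 = 1 / (1 - α) := by
    field_simp
    ring
  refine Subtype.ext (Prod.ext ?_ ?_)
  · rw [pt_fst, hn, norm_one, one_pow, hs]
    field_simp
  · rw [pt_snd, hn, norm_one, one_pow, hs]
    have : ((1 - α : ℝ) : ℂ) ≠ 0 := by exact_mod_cast h1
    push_cast at this ⊢
    simp only [star_one]
    field_simp

theorem ProjLine.pt_of_fst_ne_zero (m : ProjLine) (h : m.1.1 ≠ 0) :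
    pt 1 (star m.1.2 / (m.1.1 : ℝ)) = m := by
  obtain ⟨⟨α, β⟩, hm⟩ := m
  simp only at hm h ⊢
  have hb : ‖β‖ ^ 2 = α * (1 - α) := by linear_combination hm
  have hn : ‖star β / (α : ℂ)‖ ^ 2 = (1 - α) / α := by
    rw [norm_div, div_pow, Complex.norm_real, Real.norm_eq_abs, sq_abs, norm_star, hb]
    field_simp
  have hs : 1 + (1 - α) / α = 1 / α := by
    field_simp
    ring
  refine Subtype.ext (Prod.ext ?_ ?_)
  · rw [pt_fst, hn, norm_one, one_pow, hs]
    field_simp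
  · rw [pt_snd, hn, norm_one, one_pow, hs]
    have : (α : ℂ) ≠ 0 := by exact_mod_cast h
    push_cast
    rw [star_div₀, star_star, Complex.star_def, Complex.conj_ofReal]
    field_simp

theorem ProjLine.pt_one_zero_fst : (pt 1 0).1.1 = 1 := by simp [pt_fst]

theorem ProjLine.eq_pt_one_zero (m : ProjLine) (h : m.1.1 = 1) : m = pt 1 0 := by
  have hm := m.2
  rw [h] at hm
  have hb : m.1.2 = 0 := by
    have : ‖m.1.2‖ ^ 2 = 0 := by linarith
    simpa using this
  rw [← pt_of_fst_ne_zero m (by rw [h]; exact one_ne_zero), hb]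
  simp

theorem ProjLine.eq_zero_of_pt_eq {u v : ℂ} (h : u ≠ 0 ∨ v ≠ 0) (he : pt u v = pt 1 0) : v = 0 := by
  have h1 := congrArg (fun m => m.1.1) he
  simp only [pt_one_zero_fst] at h1
  rw [pt_fst, div_eq_one_iff_eq (norm_sq_add_ne_zero h)] at h1
  have : ‖v‖ ^ 2 = 0 := by linarith
  simpa using this

theorem ProjLine.pt_smul {c u v : ℂ} (hc : c ≠ 0) : pt (c * u) (c * v) = pt u v := by
  have hc' : ‖c‖ ≠ 0 := norm_ne_zero_iff.2 hc
  have hcc : c * star c = ((‖c‖ ^ 2 : ℝ) : ℂ) := by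
    rw [Complex.star_def, Complex.mul_conj, Complex.normSq_eq_norm_sq]
  have hn : ‖c * u‖ ^ 2 + ‖c * v‖ ^ 2 = ‖c‖ ^ 2 * (‖u‖ ^ 2 + ‖v‖ ^ 2) := by
    rw [norm_mul, norm_mul]
    ring
  refine Subtype.ext (Prod.ext ?_ ?_)
  · rw [pt_fst, pt_fst, hn, norm_mul, mul_pow, mul_div_mul_left _ _ (pow_ne_zero 2 hc')]
  · rw [pt_snd, pt_snd, hn, Complex.ofReal_mul, ← hcc, star_mul']
    rw [show c * u * (star c * star v) = c * star c * (u * star v) by ring]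
    refine mul_div_mul_left _ _ ?_
    rw [hcc]
    exact_mod_cast pow_ne_zero 2 hc'

/-! ### Roots of a binary form, as a subset of the projective line -/

/-- The point `m = [u : v]` satisfies `f (u x + v y) = 0`. -/
def IsRootAt (f : MvPolynomial (Fin 4) ℂ) (x y : Fin 4 → ℂ) (m : ProjLine) : Prop :=
  MvPolynomial.eval ((m.1.1 : ℂ) • x + star m.1.2 • y) f = 0 ∧
    MvPolynomial.eval (m.1.2 • x + ((1 - m.1.1 : ℝ) : ℂ) • y) f = 0

theorem isRootAt_pt {f : MvPolynomial (Fin 4) ℂ} {d : ℕ} (hf : f.IsHomogeneous d)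
    (x y : Fin 4 → ℂ) {u v : ℂ} (h : u ≠ 0 ∨ v ≠ 0) :
    IsRootAt f x y (ProjLine.pt u v) ↔ MvPolynomial.eval (u • x + v • y) f = 0 := by
  have hn := ProjLine.norm_sq_add_ne_zero h
  have hnC : ((‖u‖ ^ 2 + ‖v‖ ^ 2 : ℝ) : ℂ) ≠ 0 := by exact_mod_cast hn
  have huu : ((‖u‖ ^ 2 : ℝ) : ℂ) = u * star u := by
    rw [Complex.star_def, Complex.mul_conj, Complex.normSq_eq_norm_sq]
  have hvv : ((‖v‖ ^ 2 : ℝ) : ℂ) = v * star v := by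
    rw [Complex.star_def, Complex.mul_conj, Complex.normSq_eq_norm_sq]
  set n : ℂ := ((‖u‖ ^ 2 + ‖v‖ ^ 2 : ℝ) : ℂ) with hndef
  have hsn : star n = n := by rw [hndef, Complex.star_def, Complex.conj_ofReal]
  -- The columns of the projection matrix are the multiples of `(u, v)` by `star u / n` and `star v
  -- / n`, at least one of which is nonzero.
  have h1 : ((ProjLine.pt u v).1.1 : ℂ) • x + star (ProjLine.pt u v).1.2 • y =
      (star u / n) • (u • x + v • y) := by
    rw [ProjLine.pt_fst, ProjLine.pt_snd, Complex.ofReal_div, huu, ← hndef, star_div₀, star_mul',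
      star_star, hsn]
    module
  have h2 : (ProjLine.pt u v).1.2 • x + ((1 - (ProjLine.pt u v).1.1 : ℝ) : ℂ) • y =
      (star v / n) • (u • x + v • y) := by
    have : ((1 - (ProjLine.pt u v).1.1 : ℝ) : ℂ) = v * star v / n := by
      rw [← hvv, hndef, ← Complex.ofReal_div, ProjLine.pt_fst]
      congr 1
      field_simp
      ring
    rw [this, ProjLine.pt_snd, ← hndef]
    module
  rw [IsRootAt, h1, h2, eval_smul_of_isHomogeneous hf, eval_smul_of_isHomogeneous hf]
  constructor
  · rintro ⟨ha, hb⟩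
    rcases h with h | h
    · exact (mul_eq_zero.1 ha).resolve_left
        (pow_ne_zero _ (div_ne_zero (star_ne_zero.2 h) hnC))
    · exact (mul_eq_zero.1 hb).resolve_left
        (pow_ne_zero _ (div_ne_zero (star_ne_zero.2 h) hnC))
  · intro h0
    simp [h0]

/-- Simple roots depend continuously on the line. -/
theorem exists_continuous_root (f : MvPolynomial (Fin 4) ℂ) {x y : Fin 4 → ℂ} {s : ℂ}
    (h0 : MvPolynomial.eval (s • x + y) f = 0) (h1 : polyDeriv f (s • x + y) x ≠ 0) :
    ∃ ρ : (Fin 4 → ℂ) × (Fin 4 → ℂ) → ℂ, Tendsto ρ (𝓝 (x, y)) (𝓝 s) ∧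
      (∀ᶠ a in 𝓝 (x, y), MvPolynomial.eval (ρ a • a.1 + a.2) f = 0) ∧
      ∀ᶠ b in 𝓝 ((x, y), s), MvPolynomial.eval (b.2 • b.1.1 + b.1.2) f = 0 → ρ b.1 = b.2 := by
  let F : ((Fin 4 → ℂ) × (Fin 4 → ℂ)) × ℂ → ℂ :=
    fun b => MvPolynomial.eval (b.2 • b.1.1 + b.1.2) f
  have hg : ContDiff ℂ ⊤ (fun b : ((Fin 4 → ℂ) × (Fin 4 → ℂ)) × ℂ => b.2 • b.1.1 + b.1.2) := by
    fun_prop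
  have hF : ContDiff ℂ ⊤ F := (contDiff_eval f).comp hg
  have hs : HasStrictFDerivAt F (fderiv ℂ F ((x, y), s)) ((x, y), s) :=
    hF.contDiffAt.hasStrictFDerivAt (by simp)
  have happ : fderiv ℂ F ((x, y), s) (0, 1) = polyDeriv f (s • x + y) x := by
    have ha : HasDerivAt (fun t : ℂ => F ((x, y), t)) (fderiv ℂ F ((x, y), s) (0, 1)) s := by
      have := hs.hasFDerivAt.comp_hasDerivAt s
        ((hasDerivAt_const s (x, y)).prodMk (hasDerivAt_id s))
      exact this
    have hb := hasDerivAt_eval_line f y x s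
    rw [add_comm y] at hb
    refine ha.unique (hb.congr_of_eventuallyEq (Eventually.of_forall fun t => ?_))
    simp only [F, add_comm]
  have hinv : (fderiv ℂ F ((x, y), s) ∘SL ContinuousLinearMap.inr ℂ _ ℂ).IsInvertible := by
    have hne : fderiv ℂ F ((x, y), s) (0, 1) ≠ 0 := by rwa [happ]
    refine ⟨ContinuousLinearEquiv.unitsEquivAut ℂ (Units.mk0 _ hne), ?_⟩
    ext
    simp
  refine ⟨hs.implicitFunctionOfProdDomain hinv, hs.tendsto_implicitFunctionOfProdDomain hinv,
    ?_, ?_⟩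
  · filter_upwards [hs.eventually_apply_implicitFunctionOfProdDomain hinv] with a ha
    exact ha.trans h0
  · filter_upwards [hs.eventually_apply_eq_iff_implicitFunctionOfProdDomain hinv] with b hb hb0
    exact hb.1 (hb0.trans h0.symm)

/-! ### The covering space of intersection points over a family of twistor lines -/

/-- The intersection points of a surface with a family of twistor lines. -/
def rootSpace {A : Type*} (f : MvPolynomial (Fin 4) ℂ) (x : A → Fin 4 → ℂ) : Set (A × ProjLine) :=
  {e | IsRootAt f (x e.1) (jMap (x e.1)) e.2}

theorem isClosed_rootSpace {A : Type*} [TopologicalSpace A] (f : MvPolynomial (Fin 4) ℂ)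
    {x : A → Fin 4 → ℂ} (hx : Continuous x) : IsClosed (rootSpace f x) := by
  have hj : Continuous fun e : A × ProjLine => jMap (x e.1) :=
    continuous_jMap.comp (hx.comp continuous_fst)
  have hev := f.continuous_eval
  refine IsClosed.inter (isClosed_eq (hev.comp ?_) continuous_const)
    (isClosed_eq (hev.comp ?_) continuous_const) <;> fun_prop

/-- Here `c` is an affine chart with local inverse `g`. The implicit function theorem supplies a
continuous local branch of the root, which gives openness; its uniqueness gives local injectivity.
-/
theorem rootSpace_chart {A : Type*} [TopologicalSpace A] {f : MvPolynomial (Fin 4) ℂ}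
    {x : A → Fin 4 → ℂ} (e : rootSpace f x) (c : ProjLine → ℂ)
    (hc : ContinuousAt c e.1.2) (g : ℂ → ProjLine) (hg : ContinuousAt g (c e.1.2))
    (hgc : ∀ᶠ m in 𝓝 e.1.2, g (c m) = m) {P Q : A → Fin 4 → ℂ} (hP : Continuous P)
    (hQ : Continuous Q)
    (hr : ∀ a s, IsRootAt f (x a) (jMap (x a)) (g s) ↔ MvPolynomial.eval (s • P a + Q a) f = 0)
    (hne : polyDeriv f (c e.1.2 • P e.1.1 + Q e.1.1) (P e.1.1) ≠ 0) :
    𝓝 e.1.1 ≤ map (fun e : rootSpace f x => e.1.1) (𝓝 e) ∧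
      ∃ U ∈ 𝓝 e, Set.InjOn (fun e : rootSpace f x => e.1.1) U := by
  have he : g (c e.1.2) = e.1.2 := hgc.self_of_nhds
  have h0 : MvPolynomial.eval (c e.1.2 • P e.1.1 + Q e.1.1) f = 0 := by
    rw [← hr, he]
    exact e.2
  obtain ⟨ρ, hρ, hρ0, hρu⟩ := exists_continuous_root f h0 hne
  have hPQ : Continuous fun a => (P a, Q a) := hP.prodMk hQ
  have hρa : Tendsto (fun a => ρ (P a, Q a)) (𝓝 e.1.1) (𝓝 (c e.1.2)) :=
    hρ.comp (hPQ.tendsto _)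
  constructor
  · intro W hW
    rw [mem_map] at hW
    obtain ⟨W', hW', hsub⟩ := (mem_nhds_subtype _ _ _).1 hW
    have hlim : Tendsto (fun a => (a, g (ρ (P a, Q a)))) (𝓝 e.1.1) (𝓝 e.1) := by
      have : Tendsto (fun a => g (ρ (P a, Q a))) (𝓝 e.1.1) (𝓝 e.1.2) := by
        have := hg.tendsto.comp hρa
        rwa [he] at this
      exact tendsto_id.prodMk_nhds this
    filter_upwards [hlim hW', (hPQ.tendsto e.1.1).eventually hρ0] with a ha1 ha2
    exact hsub (a := ⟨(a, g (ρ (P a, Q a))), (hr a _).2 ha2⟩) ha1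
  · have hcont : Tendsto (fun b : rootSpace f x => ((P b.1.1, Q b.1.1), c b.1.2)) (𝓝 e)
        (𝓝 ((P e.1.1, Q e.1.1), c e.1.2)) := by
      refine Tendsto.prodMk_nhds ?_ ?_
      · exact (hPQ.comp (continuous_fst.comp continuous_subtype_val)).tendsto e
      · exact hc.tendsto.comp ((continuous_snd.comp continuous_subtype_val).tendsto e)
    have h1 := hcont.eventually hρu
    have h2 := ((continuous_snd.comp continuous_subtype_val).tendsto e).eventually hgc
    refine ⟨_, h1.and h2, ?_⟩
    rintro b ⟨hb1, hb2⟩ b' ⟨hb1', hb2'⟩ hbb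
    have hbb : b.1.1 = b'.1.1 := hbb
    have hb2 : g (c b.1.2) = b.1.2 := hb2
    have hb2' : g (c b'.1.2) = b'.1.2 := hb2'
    have k1 := hb1 ((hr _ _).1 (by rw [hb2]; exact b.2))
    have k2 := hb1' ((hr _ _).1 (by rw [hb2']; exact b'.2))
    refine Subtype.ext (Prod.ext hbb ?_)
    have k1 : ρ (P b.1.1, Q b.1.1) = c b.1.2 := k1
    have k2 : ρ (P b'.1.1, Q b'.1.1) = c b'.1.2 := k2
    rw [← hb2, ← hb2', ← k1, ← k2, hbb]

/-- By Euler's identity the derivative at a root `w` kills `w` itself, so transversality in the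
direction `jMap w` passes to any `y` that spans `jMap w` modulo `w`. -/
theorem Good.polyDeriv_ne_zero {f : MvPolynomial (Fin 4) ℂ} {d : ℕ} (hf : f.IsHomogeneous d)
    {z w y : Fin 4 → ℂ} (h : Good f d z) (hw : w ≠ 0) (hzw : SameFibre z w)
    (h0 : MvPolynomial.eval w f = 0) {a b : ℂ} (hy : jMap w = a • w + b • y) :
    polyDeriv f w y ≠ 0 := by
  intro hD
  apply (h.of_sameFibre hw hzw).polyDeriv_jMap_ne_zero hf h0
  rw [hy, map_add, map_smul, map_smul, polyDeriv_self hf, h0, hD]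
  simp

theorem Good.polyDeriv_add_smul_ne_zero {f : MvPolynomial (Fin 4) ℂ} {d : ℕ}
    (hf : f.IsHomogeneous d) {z : Fin 4 → ℂ} (h : Good f d z) {t : ℂ}
    (h0 : MvPolynomial.eval (z + t • jMap z) f = 0) :
    polyDeriv f (z + t • jMap z) (jMap z) ≠ 0 := by
  refine h.polyDeriv_ne_zero hf (add_smul_jMap_ne_zero h.1 _)
    (sameFibre_add_smul_jMap _ _) h0 (a := -star t) (b := 1 + star t * t) ?_
  rw [jMap_add, jMap_smul, jMap_jMap]
  module

theorem Good.polyDeriv_smul_add_ne_zero {f : MvPolynomial (Fin 4) ℂ} {d : ℕ}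
    (hf : f.IsHomogeneous d) {z : Fin 4 → ℂ} (h : Good f d z) {s : ℂ}
    (h0 : MvPolynomial.eval (s • z + jMap z) f = 0) :
    polyDeriv f (s • z + jMap z) z ≠ 0 := by
  have hne : s • z + jMap z ≠ 0 := by
    intro h1
    exact one_ne_zero (span_jMap_eq_zero h.1 (u := s) (v := 1) (by rwa [one_smul])).2
  refine h.polyDeriv_ne_zero hf hne ⟨s, 1, by rw [one_smul]⟩ h0
    (a := star s) (b := -(1 + star s * s)) ?_
  rw [jMap_add, jMap_smul, jMap_jMap]
  module

/-- Simple roots make the projection a local homeomorphism. It is closed with compact discrete,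
hence finite, fibres, and is therefore a covering. -/
theorem isCoveringMap_rootSpace {A : Type*} [TopologicalSpace A] [T2Space A]
    {f : MvPolynomial (Fin 4) ℂ} {d : ℕ} (hf : f.IsHomogeneous d) {x : A → Fin 4 → ℂ}
    (hx : Continuous x) (hG : ∀ a, Good f d (x a)) :
    IsCoveringMap (fun e : rootSpace f x => e.1.1) := by
  have hjx : Continuous fun a => jMap (x a) := continuous_jMap.comp hx
  have hclosed : IsClosedMap (fun e : rootSpace f x => e.1.1) :=
    isClosedMap_fst_of_compactSpace.comp (isClosed_rootSpace f hx).isClosedMap_subtype_val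
  have hcont : Continuous (fun e : rootSpace f x => e.1.1) :=
    continuous_fst.comp continuous_subtype_val
  have hloc : ∀ e : rootSpace f x, 𝓝 e.1.1 ≤ map (fun e : rootSpace f x => e.1.1) (𝓝 e) ∧
      ∃ U ∈ 𝓝 e, Set.InjOn (fun e : rootSpace f x => e.1.1) U := by
    intro e
    by_cases h : e.1.2.1.1 = 1
    · have hev : ∀ᶠ m : ProjLine in 𝓝 e.1.2, m.1.1 ≠ 0 :=
        (continuous_fst.comp continuous_subtype_val).continuousAt.eventually_ne
          (by simp [h])
      have hev' : ∀ᶠ m : ProjLine in 𝓝 e.1.2,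
          ProjLine.pt 1 (star m.1.2 / ((m.1.1 : ℝ) : ℂ)) = m :=
        hev.mono fun m hm => m.pt_of_fst_ne_zero hm
      have hr : ∀ a s, IsRootAt f (x a) (jMap (x a)) (ProjLine.pt 1 s) ↔
          MvPolynomial.eval (s • jMap (x a) + x a) f = 0 := fun a s => by
        rw [isRootAt_pt hf _ _ (Or.inl one_ne_zero), one_smul, add_comm]
      refine rootSpace_chart e (fun m => star m.1.2 / ((m.1.1 : ℝ) : ℂ)) ?_
        (fun s => ProjLine.pt 1 s)
        ?_ hev' hjx hx hr ?_
      · refine ContinuousAt.div (by fun_prop) (by fun_prop) ?_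
        simp [h]
      · exact ProjLine.continuousAt_pt continuousAt_const continuousAt_id (Or.inl one_ne_zero)
      · set s := star e.1.2.1.2 / ((e.1.2.1.1 : ℝ) : ℂ) with hs
        have hroot : MvPolynomial.eval (s • jMap (x e.1.1) + x e.1.1) f = 0 := by
          rw [← hr, hev'.self_of_nhds]
          exact e.2
        rw [add_comm] at hroot ⊢
        exact (hG e.1.1).polyDeriv_add_smul_ne_zero hf hroot
    · have hev : ∀ᶠ m : ProjLine in 𝓝 e.1.2, m.1.1 ≠ 1 :=
        (continuous_fst.comp continuous_subtype_val).continuousAt.eventually_ne h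
      have hev' : ∀ᶠ m : ProjLine in 𝓝 e.1.2,
          ProjLine.pt (m.1.2 / ((1 - m.1.1 : ℝ) : ℂ)) 1 = m :=
        hev.mono fun m hm => m.pt_of_fst_ne_one hm
      have hr : ∀ a s, IsRootAt f (x a) (jMap (x a)) (ProjLine.pt s 1) ↔
          MvPolynomial.eval (s • x a + jMap (x a)) f = 0 := fun a s => by
        rw [isRootAt_pt hf _ _ (Or.inr one_ne_zero), one_smul]
      refine rootSpace_chart e (fun m => m.1.2 / ((1 - m.1.1 : ℝ) : ℂ)) ?_
        (fun s => ProjLine.pt s 1)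
        ?_ hev' hx hjx hr ?_
      · refine ContinuousAt.div (by fun_prop) (by fun_prop) ?_
        exact_mod_cast sub_ne_zero.2 (Ne.symm h)
      · exact ProjLine.continuousAt_pt continuousAt_id continuousAt_const (Or.inr one_ne_zero)
      · set s := e.1.2.1.2 / ((1 - e.1.2.1.1 : ℝ) : ℂ) with hs
        have hroot : MvPolynomial.eval (s • x e.1.1 + jMap (x e.1.1)) f = 0 := by
          rw [← hr, hev'.self_of_nhds]
          exact e.2
        exact (hG e.1.1).polyDeriv_smul_add_ne_zero hf hroot
  have hopen : IsOpenMap (fun e : rootSpace f x => e.1.1) :=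
    isOpenMap_iff_nhds_le.2 fun e => (hloc e).1
  have hhomeo : IsLocalHomeomorph (fun e : rootSpace f x => e.1.1) := by
    rw [isLocalHomeomorph_iff_isOpenEmbedding_restrict]
    intro e
    obtain ⟨U, hU, hinj⟩ := (hloc e).2
    obtain ⟨W, hWU, hW, heW⟩ := mem_nhds_iff.1 hU
    refine ⟨W, hW.mem_nhds heW, ?_⟩
    exact IsOpenEmbedding.of_continuous_injective_isOpenMap (hcont.comp continuous_subtype_val)
      (Set.injOn_iff_injective.1 (hinj.mono hWU)) (hopen.domRestrict hW)
  rw [isCoveringMap_iff_isCoveringMapOn_univ]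
  refine hclosed.isCoveringMapOn_of_isLocalHomeomorphOn (fun a _ => ?_)
    (isLocalHomeomorph_iff_isLocalHomeomorphOn_univ.1 hhomeo |>.mono (Set.subset_univ _))
  have hcompact : IsCompact ((fun e : rootSpace f x => e.1.1) ⁻¹' {a}) := by
    rw [Subtype.isCompact_iff]
    have : Subtype.val '' ((fun e : rootSpace f x => e.1.1) ⁻¹' {a}) =
        rootSpace f x ∩ ({a} ×ˢ Set.univ) := by
      ext e
      constructor
      · rintro ⟨e, he, rfl⟩
        exact ⟨e.2, he, trivial⟩
      · rintro ⟨h1, h2, -⟩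
        exact ⟨⟨e, h1⟩, h2, rfl⟩
    rw [this]
    exact (isCompact_singleton.prod isCompact_univ).inter_left (isClosed_rootSpace f hx)
  refine hcompact.finite (IsDiscrete.of_openPartialHomeomorph _ subset_rfl fun e _ => ?_)
  obtain ⟨φ, hφ, h⟩ := hhomeo e
  exact ⟨φ, hφ, h.symm⟩

/-- Every intersection point extends to a continuous section over a simply connected base. -/
theorem exists_section {A : Type*} [TopologicalSpace A] [T2Space A] [SimplyConnectedSpace A]
    [LocallyPathConnectedSpace A] {f : MvPolynomial (Fin 4) ℂ} {d : ℕ} (hf : f.IsHomogeneous d)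
    {x : A → Fin 4 → ℂ} (hx : Continuous x) (hG : ∀ a, Good f d (x a)) {a : A} {m : ProjLine}
    (hm : IsRootAt f (x a) (jMap (x a)) m) :
    ∃ σ : A → ProjLine, Continuous σ ∧ σ a = m ∧
      ∀ b, IsRootAt f (x b) (jMap (x b)) (σ b) := by
  obtain ⟨F, ⟨hF1, hF2⟩, -⟩ := (isCoveringMap_rootSpace hf hx hG).existsUnique_continuousMap_lifts
    (ContinuousMap.id A) a ⟨(a, m), hm⟩ rfl
  have hF : ∀ b, (F b).1.1 = b := fun b => congrFun hF2 b
  refine ⟨fun b => (F b).1.2, by fun_prop, congrArg (fun e => e.1.2) hF1, fun b => ?_⟩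
  have : IsRootAt f (x (F b).1.1) (jMap (x (F b).1.1)) (F b).1.2 := (F b).2
  rwa [hF] at this

/-- Continuous sections that agree at one point agree everywhere. -/
theorem section_unique {A : Type*} [TopologicalSpace A] [T2Space A] [PreconnectedSpace A]
    {f : MvPolynomial (Fin 4) ℂ} {d : ℕ} (hf : f.IsHomogeneous d)
    {x : A → Fin 4 → ℂ} (hx : Continuous x) (hG : ∀ a, Good f d (x a)) {σ τ : A → ProjLine}
    (hσ : Continuous σ) (hτ : Continuous τ) (hσr : ∀ b, IsRootAt f (x b) (jMap (x b)) (σ b))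
    (hτr : ∀ b, IsRootAt f (x b) (jMap (x b)) (τ b)) {a : A} (ha : σ a = τ a) (b : A) :
    σ b = τ b := by
  have := (isCoveringMap_rootSpace hf hx hG).eq_of_comp_eq (A := A)
    (g₁ := fun b => ⟨(b, σ b), hσr b⟩) (g₂ := fun b => ⟨(b, τ b), hτr b⟩)
    (by fun_prop) (by fun_prop) rfl a (Subtype.ext (Prod.ext rfl ha))
  exact congrArg (fun e => e.1.2) (congrFun this b)

/-! ### Tangent lines avoiding the discriminant -/

theorem eq_of_continuous_of_countable {g : ℝ → ℂ} (hg : Continuous g) {s : Set ℂ}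
    (hs : s.Countable) (h : ∀ t, g t ∈ s) (t t' : ℝ) : g t = g t' :=
  (hs.mono (Set.range_subset_iff.2 h)).isTotallyDisconnected _ subset_rfl
    (isPreconnected_range hg) ⟨t, rfl⟩ ⟨t', rfl⟩

theorem ProjLine.eq_mul_of_pt_eq {u v u' v' : ℂ} (h : u ≠ 0 ∨ v ≠ 0)
    (h' : u' ≠ 0 ∨ v' ≠ 0) (he : pt u v = pt u' v') : ∃ c : ℂ, u = c * u' ∧ v = c * v' := by
  have hn : ((‖u‖ ^ 2 + ‖v‖ ^ 2 : ℝ) : ℂ) ≠ 0 := by exact_mod_cast norm_sq_add_ne_zero h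
  have key : ∀ u v : ℂ, u ≠ 0 ∨ v ≠ 0 →
      ((pt u v).1.1 : ℂ) = star u / ((‖u‖ ^ 2 + ‖v‖ ^ 2 : ℝ) : ℂ) * u ∧
      star (pt u v).1.2 = star u / ((‖u‖ ^ 2 + ‖v‖ ^ 2 : ℝ) : ℂ) * v ∧
      (pt u v).1.2 = star v / ((‖u‖ ^ 2 + ‖v‖ ^ 2 : ℝ) : ℂ) * u ∧
      1 - ((pt u v).1.1 : ℂ) = star v / ((‖u‖ ^ 2 + ‖v‖ ^ 2 : ℝ) : ℂ) * v := by
    intro u v h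
    have hn : ((‖u‖ ^ 2 + ‖v‖ ^ 2 : ℝ) : ℂ) ≠ 0 := by exact_mod_cast norm_sq_add_ne_zero h
    have huu : ((‖u‖ ^ 2 : ℝ) : ℂ) = u * star u := by
      rw [Complex.star_def, Complex.mul_conj, Complex.normSq_eq_norm_sq]
    have hvv : ((‖v‖ ^ 2 : ℝ) : ℂ) = v * star v := by
      rw [Complex.star_def, Complex.mul_conj, Complex.normSq_eq_norm_sq]
    have h1 : ((pt u v).1.1 : ℂ) = star u / ((‖u‖ ^ 2 + ‖v‖ ^ 2 : ℝ) : ℂ) * u := by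
      rw [pt_fst, Complex.ofReal_div, huu]
      ring
    refine ⟨h1, ?_, ?_, ?_⟩
    · simp only [pt_snd, star_div₀, star_mul', Complex.star_def, Complex.conj_ofReal,
        Complex.conj_conj]
      ring
    · rw [pt_snd]
      ring
    · rw [h1]
      field_simp
      rw [Complex.ofReal_add, huu, hvv]
      ring
  obtain ⟨a1, a2, a3, a4⟩ := key u v h
  obtain ⟨b1, b2, b3, b4⟩ := key u' v' h'
  rw [he] at a1 a2 a3 a4
  rcases h with h | h
  · have hc := div_ne_zero (star_ne_zero.2 h) hn
    refine ⟨(star u / ((‖u‖ ^ 2 + ‖v‖ ^ 2 : ℝ) : ℂ))⁻¹ *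
      (star u' / ((‖u'‖ ^ 2 + ‖v'‖ ^ 2 : ℝ) : ℂ)), ?_, ?_⟩
    · rw [mul_assoc, ← b1, a1, inv_mul_cancel_left₀ hc]
    · rw [mul_assoc, ← b2, a2, inv_mul_cancel_left₀ hc]
  · have hc := div_ne_zero (star_ne_zero.2 h) hn
    refine ⟨(star v / ((‖u‖ ^ 2 + ‖v‖ ^ 2 : ℝ) : ℂ))⁻¹ *
      (star v' / ((‖u'‖ ^ 2 + ‖v'‖ ^ 2 : ℝ) : ℂ)), ?_, ?_⟩
    · rw [mul_assoc, ← b3, a3, inv_mul_cancel_left₀ hc]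
    · rw [mul_assoc, ← b4, a4, inv_mul_cancel_left₀ hc]

theorem Good.smul {f : MvPolynomial (Fin 4) ℂ} {d : ℕ} {z : Fin 4 → ℂ} (h : Good f d z) {c : ℂ}
    (hc : c ≠ 0) : Good f d (c • z) :=
  h.of_sameFibre (smul_ne_zero hc h.1) ⟨c, 0, by rw [zero_smul, add_zero]⟩

/-- There are at least `d` roots over a point outside the discriminant. -/
theorem Good.exists_root_notMem {f : MvPolynomial (Fin 4) ℂ} {d : ℕ} (hf : f.IsHomogeneous d)
    {z : Fin 4 → ℂ} (h : Good f d z) (s : Finset ProjLine) (hs : s.card < d) :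
    ∃ m, IsRootAt f z (jMap z) m ∧ m ∉ s := by
  obtain ⟨P, hP0, hPz, hPf, hPinj, -⟩ := h.exists_roots hf
  choose u v huv using hPz
  have hne : ∀ i, u i ≠ 0 ∨ v i ≠ 0 := by
    intro i
    by_contra hcon
    push Not at hcon
    apply hP0 i
    rw [huv i, hcon.1, hcon.2, zero_smul, zero_smul, add_zero]
  have hinj : Function.Injective fun i => ProjLine.pt (u i) (v i) := by
    intro i k hik
    obtain ⟨c, h1, h2⟩ := ProjLine.eq_mul_of_pt_eq (hne i) (hne k) hik
    refine (hPinj k i c ?_).symm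
    rw [huv i, huv k, h1, h2]
    module
  by_contra! hcon
  have hsub : (Finset.univ.image fun i => ProjLine.pt (u i) (v i)) ⊆ s := by
    intro m hm
    obtain ⟨i, -, rfl⟩ := Finset.mem_image.1 hm
    refine hcon _ ((isRootAt_pt hf _ _ (hne i)).2 ?_)
    rw [← huv i, hPf i]
  have := Finset.card_le_card hsub
  rw [Finset.card_image_of_injective _ hinj, Finset.card_univ, Fintype.card_fin] at this
  omega

/-- Stands in for the vanishing of the winding number of `g` around circles. -/
theorem exists_continuous_log {g : ℂ → ℂ} (hg : Continuous g) (h0 : ∀ b, g b ≠ 0) :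
    ∃ l : ℂ → ℂ, Continuous l ∧ ∀ b, Complex.exp (l b) = g b := by
  obtain ⟨F, ⟨-, hF⟩, -⟩ := Complex.isCoveringMapOn_exp.existsUnique_continuousMap_lifts
    ⟨g, hg⟩ (a₀ := 0) (e₀ := Complex.log (g 0)) (Complex.exp_log (h0 0)) h0
  exact ⟨F, F.continuous, fun b => congrFun hF b⟩

/-- If a line avoids the discriminant and is tangent to the surface, some sheet of the surface
over the corresponding two-sphere avoids the line. -/
theorem exists_finite_section {f : MvPolynomial (Fin 4) ℂ} {d : ℕ} (hf : f.IsHomogeneous d)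
    {p y : Fin 4 → ℂ} (hp : MvPolynomial.eval p f = 0) (hpy : polyDeriv f p y = 0)
    (hy : MvPolynomial.eval y f ≠ 0) {x : ℂ → Fin 4 → ℂ}
    (hxdef : ∀ b, x b = ((max (1 - ‖b‖) 0 : ℝ) : ℂ) • p + b • y) (hx : Continuous x)
    (hG : ∀ b, Good f d (x b)) :
    ∃ s : ℂ → ℂ, Continuous s ∧ ∀ b, MvPolynomial.eval (s b • x b + jMap (x b)) f = 0 := by
  classical
  set R := linePoly f p y with hR
  have hRne : R ≠ 0 := by
    intro h
    apply hy
    rw [← coeff_linePoly hf p y, ← hR, h, Polynomial.coeff_zero]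
  have hcard : R.roots.toFinset.card < d := by
    refine (card_roots_lt_of_double_root hRne ?_ ?_).trans_le (natDegree_linePoly_le hf p y)
    · rw [hR, eval_linePoly, zero_smul, add_zero, hp]
    · rw [hR, eval_derivative_linePoly, zero_smul, add_zero, hpy]
  -- The inverse of `b ↦ b / (1 - ‖b‖)`, which identifies the open unit disc with the affine line `p
  -- + a • y`; outside the disc `x b` is a multiple of `y`.
  let Z : Finset ℂ := R.roots.toFinset.image fun a => a / ((1 + ‖a‖ : ℝ) : ℂ)
  have hZcard : Z.card < d := Finset.card_image_le.trans_lt hcard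
  have hZ : ∀ b, MvPolynomial.eval (x b) f = 0 → b ∈ Z := by
    intro b hb
    rw [hxdef] at hb
    by_cases h1 : ‖b‖ < 1
    · have hpos : 0 < 1 - ‖b‖ := by linarith
      have hne : ((1 - ‖b‖ : ℝ) : ℂ) ≠ 0 := by exact_mod_cast hpos.ne'
      rw [max_eq_left hpos.le] at hb
      refine Finset.mem_image.2 ⟨b / ((1 - ‖b‖ : ℝ) : ℂ), ?_, ?_⟩
      · rw [Multiset.mem_toFinset, Polynomial.mem_roots hRne, Polynomial.IsRoot, hR, eval_linePoly]
        have he : ((1 - ‖b‖ : ℝ) : ℂ) • p + b • y =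
            ((1 - ‖b‖ : ℝ) : ℂ) • (p + (b / ((1 - ‖b‖ : ℝ) : ℂ)) • y) := by
          rw [smul_add, smul_smul, mul_div_cancel₀ _ hne]
        rw [he, eval_smul_of_isHomogeneous hf] at hb
        exact (mul_eq_zero.1 hb).resolve_left (pow_ne_zero _ hne)
      · rw [norm_div, Complex.norm_real, Real.norm_eq_abs, abs_of_pos hpos]
        have : (1 + ‖b‖ / (1 - ‖b‖) : ℝ) = 1 / (1 - ‖b‖) := by
          field_simp
          ring
        rw [this, Complex.ofReal_div, Complex.ofReal_one]
        field_simp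
    · exfalso
      rw [max_eq_right (by linarith), Complex.ofReal_zero, zero_smul, zero_add,
        eval_smul_of_isHomogeneous hf] at hb
      refine mul_ne_zero (pow_ne_zero _ ?_) hy hb
      rintro rfl
      simp at h1
  have hex : ∀ b : ℂ, MvPolynomial.eval (x b) f = 0 → ∃ σ : ℂ → ProjLine, Continuous σ ∧
      σ b = ProjLine.pt 1 0 ∧ ∀ b, IsRootAt f (x b) (jMap (x b)) (σ b) := by
    intro b hb
    refine exists_section hf hx hG ((isRootAt_pt hf _ _ (Or.inl one_ne_zero)).2 ?_)
    rwa [one_smul, zero_smul, add_zero]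
  have : Nonempty ProjLine := ⟨ProjLine.pt 1 0⟩
  choose! σ hσc hσb hσr using hex
  -- A sheet meeting the line takes the value `[1 : 0]`, that is `x b`, at some `b` in `Z`. There
  -- are fewer than `d` such sheets, so some root over the base point `0` lies on none of them.
  obtain ⟨m, hm, hmn⟩ := (hG 0).exists_root_notMem hf (Z.image fun b => σ b 0)
    (Finset.card_image_le.trans_lt hZcard)
  obtain ⟨τ, hτc, hτ0, hτr⟩ := exists_section hf hx hG hm
  have hτ1 : ∀ b, (τ b).1.1 ≠ 1 := by
    intro b hb
    have hpt := ProjLine.eq_pt_one_zero _ hb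
    have hb0 : MvPolynomial.eval (x b) f = 0 := by
      have := hτr b
      rw [hpt, isRootAt_pt hf _ _ (Or.inl one_ne_zero)] at this
      simpa using this
    apply hmn
    refine Finset.mem_image.2 ⟨b, hZ b hb0, ?_⟩
    rw [← hτ0]
    exact section_unique hf hx hG (hσc b hb0) hτc (hσr b hb0) hτr
      ((hσb b hb0).trans hpt.symm) 0
  refine ⟨fun b => (τ b).1.2 / ((1 - (τ b).1.1 : ℝ) : ℂ), ?_, fun b => ?_⟩
  · refine Continuous.div (by fun_prop) (by fun_prop) fun b => ?_
    exact_mod_cast sub_ne_zero.2 (hτ1 b).symm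
  · have := hτr b
    rw [← (τ b).pt_of_fst_ne_one (hτ1 b), isRootAt_pt hf _ _ (Or.inr one_ne_zero), one_smul] at this
    exact this

/-- A line that avoids the discriminant can be tangent to the surface only in degree two. -/
theorem degree_eq_two_of_tangent_line {f : MvPolynomial (Fin 4) ℂ} {d : ℕ}
    (hf : f.IsHomogeneous d) {p y : Fin 4 → ℂ} (hp : MvPolynomial.eval p f = 0)
    (hpy : polyDeriv f p y = 0) (hy : MvPolynomial.eval y f ≠ 0) (hyG : Good f d y)
    (hG : ∀ a : ℂ, Good f d (p + a • y)) : d = 2 := by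
  let x : ℂ → Fin 4 → ℂ := fun b => ((max (1 - ‖b‖) 0 : ℝ) : ℂ) • p + b • y
  have hx : Continuous x := by fun_prop
  have hxG : ∀ b, Good f d (x b) := by
    intro b
    by_cases h1 : ‖b‖ < 1
    · have hpos : 0 < 1 - ‖b‖ := by linarith
      have hne : ((1 - ‖b‖ : ℝ) : ℂ) ≠ 0 := by exact_mod_cast hpos.ne'
      have he : x b = ((1 - ‖b‖ : ℝ) : ℂ) • (p + (b / ((1 - ‖b‖ : ℝ) : ℂ)) • y) := by
        simp only [x]
        rw [max_eq_left hpos.le, smul_add, smul_smul, mul_div_cancel₀ _ hne]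
      rw [he]
      exact (hG _).smul hne
    · have he : x b = b • y := by
        simp only [x]
        rw [max_eq_right (by linarith), Complex.ofReal_zero, zero_smul, zero_add]
      rw [he]
      refine hyG.smul ?_
      rintro rfl
      simp at h1
  obtain ⟨s, hs, hsr⟩ := exists_finite_section hf hp hpy hy (x := x) (fun _ => rfl) hx hxG
  have hjx : Continuous fun b => jMap (x b) := continuous_jMap.comp hx
  -- The derivative along the fibre on a sheet that avoids the line: nonzero by transversality, on
  -- all of `ℂ`.
  let g : ℂ → ℂ := fun b => polyDeriv f (s b • x b + jMap (x b)) (x b)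
  have hg : Continuous g := by
    have h1 : Continuous fun b => polyDeriv f (s b • x b + jMap (x b)) :=
      (continuous_polyDeriv f).comp ((hs.smul hx).add hjx)
    exact h1.clm_apply hx
  obtain ⟨l, hl, hlg⟩ := exists_continuous_log hg
    fun b => (hxG b).polyDeriv_smul_add_ne_zero hf (hsr b)
  let c : ℝ → ℂ := fun θ => Complex.exp (θ * Complex.I)
  have hc : Continuous c := by fun_prop
  have hcn : ∀ θ, ‖c θ‖ = 1 := fun θ => Complex.norm_exp_ofReal_mul_I θ
  have hc1 : ∀ θ, c θ * star (c θ) = 1 := by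
    intro θ
    rw [Complex.star_def, Complex.mul_conj, Complex.normSq_eq_norm_sq, hcn]
    simp
  have hxc : ∀ θ, x (c θ) = c θ • y := by
    intro θ
    simp [x, hcn]
  have hvec : ∀ θ, s (c θ) • x (c θ) + jMap (x (c θ)) =
      star (c θ) • (jMap y + (s (c θ) * c θ ^ 2) • y) := by
    intro θ
    rw [hxc, jMap_smul, smul_add, smul_smul, smul_smul, add_comm]
    congr 2
    linear_combination (-(s (c θ)) * c θ) * hc1 θ
  have hstar : ∀ θ, star (c θ) ≠ 0 := fun θ h => by simpa [h] using hc1 θ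
  -- Over the unit circle the fibre is fixed, so the sheet stays at one of finitely many points;
  -- only the coordinates rotate.
  have hconst : ∀ θ, s (c θ) * c θ ^ 2 = s (c 0) * c 0 ^ 2 := by
    intro θ
    have hne : linePoly f (jMap y) y ≠ 0 := by
      intro h
      apply hy
      rw [← coeff_linePoly hf (jMap y) y, h, Polynomial.coeff_zero]
    refine eq_of_continuous_of_countable (g := fun θ => s (c θ) * c θ ^ 2) (by fun_prop)
      (linePoly f (jMap y) y).roots.toFinset.finite_toSet.countable (fun t => ?_) θ 0
    rw [Finset.mem_coe, Multiset.mem_toFinset, Polynomial.mem_roots hne, Polynomial.IsRoot,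
      eval_linePoly]
    have := hsr (c t)
    rw [hvec, eval_smul_of_isHomogeneous hf] at this
    exact (mul_eq_zero.1 this).resolve_left (pow_ne_zero _ (hstar t))
  set w := jMap y + (s (c 0) * c 0 ^ 2) • y with hw
  have hgc : ∀ θ, g (c θ) = c θ ^ 2 * star (c θ) ^ d * polyDeriv f w y := by
    intro θ
    have h1 := polyDeriv_smul hf (star (c θ)) w y
    have h2 : g (c θ) = c θ * polyDeriv f (star (c θ) • w) y := by
      simp only [g]
      rw [hvec, hconst, ← hw, hxc, map_smul, smul_eq_mul]
    rw [h2]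
    linear_combination (-(c θ * polyDeriv f (star (c θ) • w) y)) * hc1 θ + c θ ^ 2 * h1
  have hexp : ∀ θ : ℝ, c θ ^ 2 * star (c θ) ^ d = Complex.exp ((2 - d) * θ * Complex.I) := by
    intro θ
    have : star (c θ) = Complex.exp (-(θ * Complex.I)) := by
      rw [Complex.exp_neg]
      exact eq_inv_of_mul_eq_one_right (hc1 θ)
    rw [this, ← Complex.exp_nat_mul, ← Complex.exp_nat_mul, ← Complex.exp_add]
    congr 1
    push_cast
    ring
  -- On the circle `g` is a constant times `exp ((2 - d) θ i)`, while its logarithm is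
  -- single-valued. Comparing `θ = 0` with `θ = 2π` forces `2 - d = 0`.
  have hψ := eq_of_continuous_of_countable
    (g := fun θ : ℝ => l (c θ) - (2 - d) * θ * Complex.I) (by fun_prop)
    (s := Set.range fun n : ℤ => l (c 0) + n * (2 * Real.pi * Complex.I)) (Set.countable_range _)
    (fun θ => by
      have : Complex.exp (l (c θ) - (2 - d) * θ * Complex.I) = Complex.exp (l (c 0)) := by
        have h0 := hgc 0
        rw [hexp] at h0
        rw [Complex.exp_sub, hlg, hlg, hgc, hexp, h0,
          mul_div_cancel_left₀ _ (Complex.exp_ne_zero _)]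
        simp
      obtain ⟨n, hn⟩ := Complex.exp_eq_exp_iff_exists_int.1 this
      exact ⟨n, hn.symm⟩) 0 (2 * Real.pi)
  have hper : c (2 * Real.pi) = c 0 := by
    simp [c, Complex.exp_two_pi_mul_I]
  simp only [hper] at hψ
  have hfin : ((2 - d : ℂ)) * ((2 * Real.pi : ℝ) : ℂ) * Complex.I = 0 := by
    push_cast at hψ ⊢
    linear_combination hψ
  have hpi : ((2 * Real.pi : ℝ) : ℂ) ≠ 0 := by exact_mod_cast Real.two_pi_pos.ne'
  have h2 : (2 - d : ℂ) = 0 := by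
    simpa [Complex.I_ne_zero, hpi, Real.pi_ne_zero] using hfin
  have h3 : (d : ℂ) = ((2 : ℕ) : ℂ) := by
    push_cast
    linear_combination -h2
  exact_mod_cast h3

/-! ### Quadrics -/

/-- A double root at `p` and a root at infinity are too many for a nonzero polynomial of degree at
most two. -/
theorem eval_add_eq_zero_of_quadric {f : MvPolynomial (Fin 4) ℂ} (hf : f.IsHomogeneous 2)
    {p y : Fin 4 → ℂ} (hp : MvPolynomial.eval p f = 0) (hpy : polyDeriv f p y = 0)
    (hy : MvPolynomial.eval y f = 0) (a b : ℂ) : MvPolynomial.eval (a • p + b • y) f = 0 := by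
  have hP : linePoly f p y = 0 := by
    by_contra hne
    have h1 : (linePoly f p y).natDegree ≠ 2 := by
      intro h
      apply hne
      rw [← Polynomial.leadingCoeff_eq_zero, Polynomial.leadingCoeff, h, coeff_linePoly hf, hy]
    have h2 := natDegree_linePoly_le hf p y
    have h3 : (linePoly f p y).roots.toFinset.card < (linePoly f p y).natDegree := by
      refine card_roots_lt_of_double_root hne ?_ ?_
      · rw [eval_linePoly, zero_smul, add_zero, hp]
      · rw [eval_derivative_linePoly, zero_smul, add_zero, hpy]
    have h4 : 0 < (linePoly f p y).roots.toFinset.card := by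
      refine Finset.card_pos.2 ⟨0, ?_⟩
      rw [Multiset.mem_toFinset, Polynomial.mem_roots hne, Polynomial.IsRoot, eval_linePoly,
        zero_smul, add_zero, hp]
    omega
  by_cases ha : a = 0
  · rw [ha, zero_smul, zero_add, eval_smul_of_isHomogeneous hf, hy, mul_zero]
  · have he : a • p + b • y = a • (p + (b / a) • y) := by
      rw [smul_add, smul_smul, mul_div_cancel₀ _ ha]
    rw [he, eval_smul_of_isHomogeneous hf, ← eval_linePoly, hP, Polynomial.eval_zero, mul_zero]

/-- The tangent plane of a quadric at `p` contains two lines through `p`; transporting `p` along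
a triangle of fibres shows that they meet each twistor line outside the discriminant in the same
point. -/
theorem proportional_of_quadric {f : MvPolynomial (Fin 4) ℂ} (hf : f.IsHomogeneous 2)
    {p y₀ y₁ : Fin 4 → ℂ} (hp : MvPolynomial.eval p f = 0)
    (hp₀ : polyDeriv f p y₀ = 0) (hp₁ : polyDeriv f p y₁ = 0)
    (h₀ : MvPolynomial.eval y₀ f = 0) (h₁ : MvPolynomial.eval y₁ f = 0) (h₀₁ : SameFibre y₀ y₁)
    (hG : ∀ τ t : ℝ, 0 ≤ τ → τ ≤ 1 → 0 ≤ t → t ≤ 1 →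
      Good f 2 (((1 - τ : ℝ) : ℂ) • p + (τ : ℂ) • (((1 - t : ℝ) : ℂ) • y₀ + (t : ℂ) • y₁))) :
    ∃ c : ℂ, y₀ = c • y₁ := by
  -- Clamping to `[0, 1]` extends the triangle to a family over the simply connected base `ℝ × ℝ`.
  let k : ℝ → ℝ := fun r => max 0 (min 1 r)
  have hk : Continuous k := by fun_prop
  have hk0 : ∀ r, 0 ≤ k r := fun r => le_max_left _ _
  have hk1 : ∀ r, k r ≤ 1 := fun r => max_le zero_le_one (min_le_left _ _)
  have k0 : k 0 = 0 := by simp [k]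
  have k1 : k 1 = 1 := by simp [k]
  let ω : ℝ → Fin 4 → ℂ := fun t => ((1 - k t : ℝ) : ℂ) • y₀ + (k t : ℂ) • y₁
  have hω : Continuous ω := by fun_prop
  let x : ℝ × ℝ → Fin 4 → ℂ := fun c => ((1 - k c.1 : ℝ) : ℂ) • p + (k c.1 : ℂ) • ω c.2
  have hx : Continuous x := by fun_prop
  have hxG : ∀ c, Good f 2 (x c) := fun c => hG _ _ (hk0 _) (hk1 _) (hk0 _) (hk1 _)
  have hx0 : ∀ t, x (0, t) = p := fun t => by simp [x, k0]
  have hx1 : ∀ t, x (1, t) = ω t := fun t => by simp [x, k1]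
  have ω0 : ω 0 = y₀ := by simp [ω, k0]
  have ω1 : ω 1 = y₁ := by simp [ω, k1]
  have hωG : ∀ t, Good f 2 (ω t) := fun t => by rw [← hx1]; exact hxG _
  have hroot : ∀ z : Fin 4 → ℂ, MvPolynomial.eval z f = 0 →
      IsRootAt f z (jMap z) (ProjLine.pt 1 0) := by
    intro z hz
    rw [isRootAt_pt hf _ _ (Or.inl one_ne_zero), one_smul, zero_smul, add_zero, hz]
  obtain ⟨σ, hσ, hσ0, hσr⟩ := exists_section hf hx hxG (a := (0, 0)) (m := ProjLine.pt 1 0)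
    (hroot _ (by rw [hx0, hp]))
  have hleft : ∀ t, σ (0, t) = ProjLine.pt 1 0 := by
    intro t
    refine section_unique hf (x := fun t : ℝ => x (0, t)) (by fun_prop) (fun t => hxG _)
      (σ := fun t => σ (0, t)) (τ := fun _ => ProjLine.pt 1 0) (by fun_prop) continuous_const
      (fun t => hσr _) (fun t => hroot _ ?_) (a := 0) hσ0 t
    rw [hx0, hp]
  -- On a side that lies in the surface, the vector `x` is itself a section, with coordinates `[1 :
  -- 0]`.
  have hside : ∀ t, MvPolynomial.eval (ω t) f = 0 → polyDeriv f p (ω t) = 0 →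
      σ (1, t) = ProjLine.pt 1 0 := by
    intro t ht ht'
    refine section_unique hf (x := fun r : ℝ => x (r, t)) (by fun_prop) (fun t => hxG _)
      (σ := fun r => σ (r, t)) (τ := fun _ => ProjLine.pt 1 0) (by fun_prop) continuous_const
      (fun t => hσr _) (fun r => hroot _ ?_) (a := 0) (hleft t) 1
    exact eval_add_eq_zero_of_quadric hf hp ht' ht _ _
  have hbot : σ (1, 0) = ProjLine.pt 1 0 := hside 0 (by rw [ω0, h₀]) (by rw [ω0, hp₀])
  have htop : σ (1, 1) = ProjLine.pt 1 0 := hside 1 (by rw [ω1, h₁]) (by rw [ω1, hp₁])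
  -- On the side opposite `p` all vectors lie in one fibre. The fixed point `y₀` is a section there,
  -- and `u t`, `v t` are its homogeneous coordinates relative to `ω t`.
  let u : ℝ → ℂ := fun t => star (ω t) ⬝ᵥ y₀
  let v : ℝ → ℂ := fun t => star (jMap (ω t)) ⬝ᵥ y₀
  have hy₀ : y₀ ≠ 0 := by rw [← ω0]; exact (hωG 0).1
  have hy₁ : y₁ ≠ 0 := by rw [← ω1]; exact (hωG 1).1
  have hfib : ∀ t, SameFibre (ω t) y₀ := by
    intro t
    obtain ⟨a, b, hab⟩ := h₀₁
    refine SameFibre.symm hy₀ (hωG t).1 ⟨((1 - k t : ℝ) : ℂ) + (k t : ℂ) * a, (k t : ℂ) * b, ?_⟩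
    simp only [ω]
    rw [hab]
    module
  have huv : ∀ t, u t • ω t + v t • jMap (ω t) = (star (ω t) ⬝ᵥ ω t) • y₀ := by
    intro t
    obtain ⟨a, b, hab⟩ := hfib t
    have hu : u t = a * (star (ω t) ⬝ᵥ ω t) := by
      simp only [u]
      rw [hab, dotProduct_span_jMap_left]
    have hv : v t = b * (star (ω t) ⬝ᵥ ω t) := by
      simp only [v]
      rw [hab, dotProduct_span_jMap_right]
    rw [hu, hv]
    refine Eq.trans ?_ (congrArg (fun z => (star (ω t) ⬝ᵥ ω t) • z) hab.symm)
    module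
  have hne : ∀ t, u t ≠ 0 ∨ v t ≠ 0 := by
    intro t
    by_contra h
    push Not at h
    have := huv t
    rw [h.1, h.2, zero_smul, zero_smul, add_zero, eq_comm, smul_eq_zero] at this
    exact this.elim (star_dotProduct_self_ne_zero (hωG t).1) hy₀
  have hu : Continuous u := by
    simp only [u, dotProduct]
    fun_prop
  have hv : Continuous v := by
    have : Continuous fun t => jMap (ω t) := continuous_jMap.comp hω
    simp only [v, dotProduct]
    fun_prop
  have hfinal : σ (1, 1) = ProjLine.pt (u 1) (v 1) := by
    refine section_unique hf (x := ω) hω hωG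
      (σ := fun t => σ (1, t)) (τ := fun t => ProjLine.pt (u t) (v t)) (by fun_prop)
      (continuous_iff_continuousAt.2 fun t =>
        ProjLine.continuousAt_pt hu.continuousAt hv.continuousAt (hne t))
      (fun t => by rw [← hx1]; exact hσr _) (fun t => ?_) (a := 0) ?_ 1
    · rw [isRootAt_pt hf _ _ (hne t), huv, eval_smul_of_isHomogeneous hf, h₀, mul_zero]
    · have hv0 : v 0 = 0 := by
        simp only [v]
        rw [ω0, star_jMap_dotProduct]
      have hu0 : u 0 ≠ 0 := (hne 0).resolve_right (not_not.2 hv0)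
      show σ (1, 0) = _
      rw [hbot, hv0]
      have := ProjLine.pt_smul (u := 1) (v := 0) hu0
      rw [mul_one, mul_zero] at this
      exact this.symm
  have hv1 : v 1 = 0 := ProjLine.eq_zero_of_pt_eq (hne 1) (hfinal.symm.trans htop)
  have h := huv 1
  rw [hv1, zero_smul, add_zero, ω1] at h
  refine ⟨(star y₁ ⬝ᵥ y₁)⁻¹ * u 1, ?_⟩
  rw [mul_smul, h, inv_smul_smul₀ (star_dotProduct_self_ne_zero hy₁)]

/-! ### The twistor line of a tangent plane -/

/-- These points lie in the plane `φ = 0` but off its twistor line, since `φ ∘ jMap` is nonzero on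
them. A fibre through such a point meets the plane only there, so distinct parameters lie over
distinct points. -/
theorem finite_not_good_add {f : MvPolynomial (Fin 4) ℂ} {d : ℕ}
    (hS : (Disc d (zeroLocus f)).Finite) {φ : (Fin 4 → ℂ) →L[ℂ] ℂ} {p y₀ y₁ : Fin 4 → ℂ}
    (hp : φ p = 0) (hjp : φ (jMap p) ≠ 0) (h₀ : φ y₀ = 0) (hj₀ : φ (jMap y₀) = 0)
    (h₁ : φ y₁ = 0) (hj₁ : φ (jMap y₁) = 0)
    (hli : ∀ a b : ℂ, a • y₀ + b • y₁ = 0 → a = 0 ∧ b = 0) :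
    {c : ℂ × ℂ | ¬ Good f d (p + (c.1 • y₀ + c.2 • y₁))}.Finite := by
  have hjK : ∀ a b : ℂ, φ (jMap (a • y₀ + b • y₁)) = 0 := by
    intro a b
    simp [jMap_add, jMap_smul, hj₀, hj₁]
  refine finite_not_good hS _ (fun c h => hjp ?_) fun c c' h => ?_
  · have := congrArg (fun z => φ (jMap z)) h
    simpa [jMap_add, jMap_smul, jMap_zero, hj₀, hj₁] using this
  · obtain ⟨u, v, h⟩ := h
    have h1 := congrArg φ h
    have hv : v = 0 := by simpa [jMap_add, jMap_smul, hp, h₀, h₁, hj₀, hj₁, hjp] using h1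
    rw [hv, zero_smul, add_zero] at h
    have h2 := congrArg (fun z => φ (jMap z)) h
    simp only [jMap_add p, jMap_smul u, map_add, map_smul, hjK, add_zero, smul_eq_mul] at h2
    have hu : star u = 1 := mul_right_cancel₀ hjp (by rw [← h2, one_mul])
    have hu : u = 1 := by rw [← star_star u, hu, star_one]
    rw [hu, one_smul] at h
    have h3 := hli (c'.1 - c.1) (c'.2 - c.2) (by linear_combination (norm := module) h)
    exact Prod.ext (by linear_combination -h3.1) (by linear_combination -h3.2)

/-- If the discriminant is finite, the twistor line contained in a tangent plane lies over the
discriminant. -/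
theorem not_good_of_tangent {f : MvPolynomial (Fin 4) ℂ} {d : ℕ} (hf : f.IsHomogeneous d)
    (hd : 2 ≤ d) (hS : (Disc d (zeroLocus f)).Finite) {p e : Fin 4 → ℂ} (hpG : Good f d p)
    (hp : MvPolynomial.eval p f = 0) (he : polyDeriv f p e = 0)
    (hje : polyDeriv f p (jMap e) = 0) : ¬ Good f d e := by
  intro heG
  have hpp : polyDeriv f p p = 0 := by rw [polyDeriv_self hf, hp, mul_zero]
  have hjp := hpG.polyDeriv_jMap_ne_zero hf hp
  have hK : ∀ z, SameFibre e z → polyDeriv f p z = 0 := by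
    rintro z ⟨u, v, rfl⟩
    simp [he, hje]
  have hjK : ∀ z, SameFibre e z → polyDeriv f p (jMap z) = 0 := by
    rintro z ⟨u, v, rfl⟩
    simp [jMap_span, he, hje]
  rcases hd.eq_or_lt with rfl | hd
  · obtain ⟨P, hP0, hPe, hPf, hPinj, -⟩ := heG.exists_roots hf
    have hprop : ∀ c : ℂ, P 0 ≠ c • P 1 := fun c hc => by simpa using hPinj 1 0 c hc
    have hli : ∀ a b : ℂ, a • P 0 + b • P 1 = 0 → a = 0 ∧ b = 0 := by
      intro a b hab
      have ha : a = 0 := by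
        by_contra ha
        apply hprop (-(a⁻¹ * b))
        have : a⁻¹ • (a • P 0 + b • P 1) = 0 := by rw [hab, smul_zero]
        rw [smul_add, inv_smul_smul₀ ha] at this
        linear_combination (norm := module) this
      rw [ha, zero_smul, zero_add, smul_eq_zero] at hab
      exact ⟨ha, hab.resolve_right (hP0 1)⟩
    have hfin := finite_not_good_add hS hpp hjp (hK _ (hPe 0)) (hjK _ (hPe 0)) (hK _ (hPe 1))
      (hjK _ (hPe 1)) hli
    -- The coefficients met on the triangle are real multiples of `ζ` and `ξ`; slopes `k` and `l`
    -- outside a finite set keep the nonzero ones away from bad parameters.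
    obtain ⟨k, hk⟩ := (hfin.image fun c => c.1.im / c.1.re).exists_notMem
    obtain ⟨l, hl⟩ := (hfin.image fun c => c.2.im / c.2.re).exists_notMem
    let ζ : ℂ := ⟨1, k⟩
    let ξ : ℂ := ⟨1, l⟩
    have hζ : ζ ≠ 0 := fun h => by simpa [ζ] using congrArg Complex.re h
    have hξ : ξ ≠ 0 := fun h => by simpa [ξ] using congrArg Complex.re h
    have hfib : SameFibre (ζ • P 0) (ξ • P 1) := by
      have h1 : SameFibre (P 0) (P 1) :=
        ((hPe 0).symm heG.1 (hP0 0)).trans (hP0 0) heG.1 (hP0 1) (hPe 1)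
      refine SameFibre.trans (smul_ne_zero hζ (hP0 0)) (hP0 0) (smul_ne_zero hξ (hP0 1))
        ⟨ζ⁻¹, 0, ?_⟩
        (h1.trans (hP0 0) (hP0 1) (smul_ne_zero hξ (hP0 1)) ⟨ξ, 0, ?_⟩)
      · rw [inv_smul_smul₀ hζ, zero_smul, add_zero]
      · rw [zero_smul, add_zero]
    obtain ⟨c, hc⟩ := proportional_of_quadric hf (y₀ := ζ • P 0) (y₁ := ξ • P 1) hp
      (by rw [map_smul, hK _ (hPe 0), smul_zero]) (by rw [map_smul, hK _ (hPe 1), smul_zero])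
      (by rw [eval_smul_of_isHomogeneous hf, hPf, mul_zero])
      (by rw [eval_smul_of_isHomogeneous hf, hPf, mul_zero]) hfib (by
        intro τ t hτ0 hτ1 ht0 ht1
        rcases hτ1.eq_or_lt with rfl | hτ1
        · have hvec : (((1 - 1 : ℝ) : ℂ) • p + ((1 : ℝ) : ℂ) •
              (((1 - t : ℝ) : ℂ) • ζ • P 0 + (t : ℂ) • ξ • P 1)) =
              (((1 - t : ℝ) : ℂ) * ζ) • P 0 + ((t : ℂ) * ξ) • P 1 := by
            rw [sub_self, Complex.ofReal_zero, Complex.ofReal_one]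
            module
          rw [hvec]
          obtain ⟨a, b, hab⟩ := hPe 0
          obtain ⟨a', b', hab'⟩ := hPe 1
          refine heG.of_sameFibre (fun h0 => ?_) ⟨((1 - t : ℝ) : ℂ) * ζ * a + t * ξ * a',
            ((1 - t : ℝ) : ℂ) * ζ * b + t * ξ * b', ?_⟩
          · obtain ⟨h1, h2⟩ := hli _ _ h0
            have h1 := (mul_eq_zero.1 h1).resolve_right hζ
            have h2 := (mul_eq_zero.1 h2).resolve_right hξ
            have h1 : 1 - t = 0 := by exact_mod_cast h1
            have h2 : t = 0 := by exact_mod_cast h2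
            linarith
          · rw [hab, hab']
            module
        · have hpos : 0 < 1 - τ := by linarith
          have hne : ((1 - τ : ℝ) : ℂ) ≠ 0 := by exact_mod_cast hpos.ne'
          set r : ℝ := τ / (1 - τ) with hr
          have hr0 : 0 ≤ r := by positivity
          have hτr : (τ : ℂ) = ((1 - τ : ℝ) : ℂ) * (r : ℂ) := by
            rw [← Complex.ofReal_mul, hr, mul_div_cancel₀ _ hpos.ne']
          have hvec : (((1 - τ : ℝ) : ℂ) • p + (τ : ℂ) •
              (((1 - t : ℝ) : ℂ) • ζ • P 0 + (t : ℂ) • ξ • P 1)) = ((1 - τ : ℝ) : ℂ) •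
              (p + ((((r * (1 - t) : ℝ) : ℂ) * ζ) • P 0 + (((r * t : ℝ) : ℂ) * ξ) • P 1)) := by
            rw [hτr]
            push_cast
            module
          rw [hvec]
          refine Good.smul ?_ hne
          by_contra hbad
          have hmem : ((((r * (1 - t) : ℝ) : ℂ) * ζ), (((r * t : ℝ) : ℂ) * ξ)) ∈
            {c : ℂ × ℂ | ¬ Good f 2 (p + (c.1 • P 0 + c.2 • P 1))} := hbad
          by_cases h1 : r * (1 - t) = 0
          · by_cases h2 : r * t = 0
            · apply hbad
              rw [h1, h2]
              simpa using hpG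
            · exact hl ⟨_, hmem, by simp [ξ, mul_div_cancel_left₀ _ h2]⟩
          · exact hk ⟨_, hmem, by simp [ζ, mul_div_cancel_left₀ _ h1]⟩)
    apply hprop (ζ⁻¹ * (c * ξ))
    rw [mul_smul, mul_smul, ← hc, inv_smul_smul₀ hζ]
  · have hfin := finite_not_good_add hS hpp hjp he hje (hK _ ⟨0, 1, by simp⟩)
      (hjK _ ⟨0, 1, by simp⟩) (y₁ := jMap e) fun a b => span_jMap_eq_zero heG.1
    -- The ratio `t` picks a point `y` of the twistor line off the surface such that no `p + a • y`
    -- with `a ≠ 0` is bad.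
    obtain ⟨t, ht⟩ := ((hfin.image fun c => c.2 / c.1).union
      (linePoly f e (jMap e)).roots.toFinset.finite_toSet).exists_notMem
    rw [Set.mem_union, not_or] at ht
    set y := e + t • jMap e with hy
    have hyf : SameFibre e y := sameFibre_add_smul_jMap e t
    refine hd.ne' (degree_eq_two_of_tangent_line hf (y := y) hp (hK _ hyf) ?_
      (heG.of_sameFibre (add_smul_jMap_ne_zero heG.1 t) hyf) fun a => ?_)
    · intro h0
      apply ht.2
      rw [Finset.mem_coe, Multiset.mem_toFinset, Polynomial.mem_roots (heG.linePoly_ne_zero hf),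
        Polynomial.IsRoot, eval_linePoly, h0]
    · by_contra hbad
      by_cases ha : a = 0
      · apply hbad
        rwa [ha, zero_smul, add_zero]
      · refine ht.1 ⟨(a, a * t), ?_, mul_div_cancel_left₀ _ ha⟩
        show ¬ Good f d (p + (a • e + (a * t) • jMap e))
        rwa [mul_smul, ← smul_add]

/-! ### Tangent planes are contained in the surface -/

theorem isClosed_sameFibre (z : Fin 4 → ℂ) : IsClosed {w | SameFibre z w} := by
  have : {w | SameFibre z w} = (Submodule.span ℂ {z, jMap z} : Submodule ℂ (Fin 4 → ℂ)) := by
    ext w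
    rw [SetLike.mem_coe, Submodule.mem_span_pair]
    exact ⟨fun ⟨u, v, h⟩ => ⟨u, v, h.symm⟩, fun ⟨u, v, h⟩ => ⟨u, v, h.symm⟩⟩
  rw [this]
  exact Submodule.closed_of_finiteDimensional _

theorem eventually_good {f : MvPolynomial (Fin 4) ℂ} {d : ℕ}
    (hS : (Disc d (zeroLocus f)).Finite) {p : Fin 4 → ℂ} (hp : Good f d p) :
    ∀ᶠ w in 𝓝 p, Good f d w := by
  choose ζ hζ0 hζ using exists_twistorProj_mk
  have h1 : ∀ᶠ w in 𝓝 p, ∀ q ∈ Disc d (zeroLocus f), ¬ SameFibre (ζ q) w := by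
    rw [eventually_all_finite hS]
    intro q hq
    refine (isClosed_sameFibre (ζ q)).isOpen_compl.mem_nhds fun h => hp.2 ?_
    rwa [(twistorProj_mk_eq_iff (hζ0 q) hp.1).2 h, hζ]
  filter_upwards [h1, isOpen_ne.mem_nhds hp.1] with w hw hw0
  refine ⟨hw0, fun hmem => hw _ hmem ?_⟩
  rw [← twistorProj_mk_eq_iff (hζ0 _) hw0, hζ]

theorem apply_eq_zero_of_sameFibre {φ : (Fin 4 → ℂ) →L[ℂ] ℂ} {e z : Fin 4 → ℂ} (h : φ e = 0)
    (hj : φ (jMap e) = 0) (hz : SameFibre e z) : φ z = 0 ∧ φ (jMap z) = 0 := by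
  obtain ⟨u, v, rfl⟩ := hz
  simp [jMap_span, h, hj]

/-- Near a point outside the discriminant, the tangent planes of the surface all contain the
same twistor line. -/
theorem exists_eventually_polyDeriv_eq_zero {f : MvPolynomial (Fin 4) ℂ} {d : ℕ}
    (hf : f.IsHomogeneous d) (hd : 2 ≤ d) (hS : (Disc d (zeroLocus f)).Finite)
    {p : Fin 4 → ℂ} (hpG : Good f d p) (hp : MvPolynomial.eval p f = 0) :
    ∃ e, e ≠ 0 ∧ polyDeriv f p e = 0 ∧ polyDeriv f p (jMap e) = 0 ∧
      ∀ᶠ w in 𝓝 p, MvPolynomial.eval w f = 0 →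
        polyDeriv f w e = 0 ∧ polyDeriv f w (jMap e) = 0 := by
  obtain ⟨e, he0, he, hje⟩ :=
    exists_apply_eq_zero_and_apply_jMap_eq_zero (polyDeriv f p : (Fin 4 → ℂ) →ₗ[ℂ] ℂ)
  refine ⟨e, he0, he, hje, ?_⟩
  have hφ : (polyDeriv f p : (Fin 4 → ℂ) →ₗ[ℂ] ℂ) ≠ 0 := fun h =>
    hpG.polyDeriv_jMap_ne_zero hf hp (LinearMap.congr_fun h _)
  choose ζ hζ0 hζ using exists_twistorProj_mk
  have hcont : ∀ y, Continuous fun w => polyDeriv f w y := fun y =>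
    (continuous_polyDeriv f).clm_apply continuous_const
  -- The tangent plane at `p` contains no twistor line other than that of `e`. By continuity, nearby
  -- tangent planes avoid the finitely many other lines over the discriminant.
  have h1 : ∀ᶠ w in 𝓝 p, ∀ q ∈ Disc d (zeroLocus f), ¬ SameFibre (ζ q) e →
      ¬ (polyDeriv f w (ζ q) = 0 ∧ polyDeriv f w (jMap (ζ q)) = 0) := by
    rw [eventually_all_finite hS]
    intro q _
    by_cases hq : SameFibre (ζ q) e
    · exact Eventually.of_forall fun w h => absurd hq h
    · have : ¬ (polyDeriv f p (ζ q) = 0 ∧ polyDeriv f p (jMap (ζ q)) = 0) := fun h =>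
        hq (sameFibre_of_apply_eq_zero hφ (hζ0 q) he0 h.1 h.2 he hje)
      rw [not_and_or] at this
      rcases this with h | h
      · filter_upwards [(hcont _).continuousAt.eventually_ne h] with w hw _ hw'
        exact hw hw'.1
      · filter_upwards [(hcont _).continuousAt.eventually_ne h] with w hw _ hw'
        exact hw hw'.2
  filter_upwards [h1, eventually_good hS hpG] with w hw hwG hw0
  obtain ⟨e', he0', he', hje'⟩ :=
    exists_apply_eq_zero_and_apply_jMap_eq_zero (polyDeriv f w : (Fin 4 → ℂ) →ₗ[ℂ] ℂ)
  have hng := not_good_of_tangent hf hd hS hwG hw0 he' hje'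
  set q := twistorProj (Projectivization.mk ℂ e' he0') with hq
  have hqS : q ∈ Disc d (zeroLocus f) := by
    by_contra h
    exact hng ⟨he0', h⟩
  have hfib : SameFibre e' (ζ q) := (twistorProj_mk_eq_iff he0' (hζ0 q)).1 (hζ q)
  have hv := apply_eq_zero_of_sameFibre he' hje' hfib
  have hqe : SameFibre (ζ q) e := by
    by_contra h
    exact hw q hqS h hv
  exact apply_eq_zero_of_sameFibre hv.1 hv.2 hqe

/-- If `x` is tangent to the surface at all its points near `p`, the line through `p` in the
direction `x` is contained in the surface. -/
theorem eval_add_smul_eq_zero {f : MvPolynomial (Fin 4) ℂ} {p x y : Fin 4 → ℂ}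
    (hp : MvPolynomial.eval p f = 0) (hy : polyDeriv f p y ≠ 0)
    (hx : ∀ᶠ w in 𝓝 p, MvPolynomial.eval w f = 0 → polyDeriv f w x = 0) (s : ℂ) :
    MvPolynomial.eval (p + s • x) f = 0 := by
  let F : ℂ × ℂ → ℂ := fun b => MvPolynomial.eval (p + b.1 • x + b.2 • y) f
  have hg : ContDiff ℂ 1 (fun b : ℂ × ℂ => p + b.1 • x + b.2 • y) := by fun_prop
  have hF : ContDiffAt ℂ 1 F (0, 0) := (((contDiff_eval f).of_le le_top).comp hg).contDiffAt
  have hF0 : F (0, 0) = 0 := by simp [F, hp]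
  have happ : fderiv ℂ F (0, 0) (0, 1) = polyDeriv f p y := by
    have h0 := (hF.differentiableAt (by simp)).hasFDerivAt
    have ha : HasDerivAt (fun t : ℂ => F (0, t)) (fderiv ℂ F (0, 0) (0, 1)) 0 :=
      h0.comp_hasDerivAt (0 : ℂ) ((hasDerivAt_const (0 : ℂ) (0 : ℂ)).prodMk (hasDerivAt_id (0 : ℂ)))
    have hb := hasDerivAt_eval_line f p y 0
    rw [zero_smul, add_zero] at hb
    refine ha.unique (hb.congr_of_eventuallyEq (Eventually.of_forall fun t => ?_))
    simp [F]
  have hinv : (fderiv ℂ F (0, 0) ∘SL ContinuousLinearMap.inr ℂ ℂ ℂ).IsInvertible := by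
    have hne : fderiv ℂ F (0, 0) (0, 1) ≠ 0 := by rwa [happ]
    refine ⟨ContinuousLinearEquiv.unitsEquivAut ℂ (Units.mk0 _ hne), ?_⟩
    ext
    simp
  let c : ℂ → ℂ := hF.implicitFunction one_ne_zero hinv
  have hc0 : c 0 = 0 := hF.implicitFunction_apply_self one_ne_zero hinv
  have hcF : ∀ᶠ s in 𝓝 (0 : ℂ), F (s, c s) = 0 := by
    filter_upwards [hF.eventually_apply_implicitFunction one_ne_zero hinv] with s hs
    exact hs.trans hF0
  have hcC : ContDiffAt ℂ 1 c 0 := hF.contDiffAt_implicitFunction one_ne_zero hinv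
  have hcD : ∀ᶠ s in 𝓝 (0 : ℂ), DifferentiableAt ℂ c s :=
    (hcC.eventually (by simp)).mono fun s hs => hs.differentiableAt (by simp)
  -- Inside the plane `p + s • x + t • y` the surface is the graph `t = c s`. Tangency of `x` along
  -- it gives `c' = 0`, hence `c = 0` near `0`.
  let γ : ℂ → Fin 4 → ℂ := fun s => p + s • x + c s • y
  have hγ0 : γ 0 = p := by simp [γ, hc0]
  have hγ : Tendsto γ (𝓝 0) (𝓝 p) := by
    have : ContinuousAt γ 0 := by
      have := hcC.continuousAt
      fun_prop
    rw [← hγ0]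
    exact this
  have hyne : ∀ᶠ w in 𝓝 p, polyDeriv f w y ≠ 0 :=
    ((continuous_polyDeriv f).clm_apply continuous_const).continuousAt.eventually_ne hy
  have hderiv : ∀ᶠ s in 𝓝 (0 : ℂ), DifferentiableAt ℂ c s ∧ deriv c s = 0 ∧ F (s, c s) = 0 := by
    filter_upwards [hcD, hcF.eventually_nhds, hγ.eventually hx, hγ.eventually hyne]
      with s h1 h2 h3 h4
    refine ⟨h1, ?_, h2.self_of_nhds⟩
    have hd : HasDerivAt γ (x + deriv c s • y) s := by
      have := (((hasDerivAt_id s).smul_const x).const_add p).add (h1.hasDerivAt.smul_const y)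
      rw [one_smul] at this
      exact this
    have hd' := (hasFDerivAt_eval f (γ s)).comp_hasDerivAt s hd
    have h0 : HasDerivAt (fun s => MvPolynomial.eval (γ s) f) 0 s :=
      (hasDerivAt_const s (0 : ℂ)).congr_of_eventuallyEq h2
    have := hd'.unique h0
    rw [map_add, map_smul, h3 h2.self_of_nhds, zero_add, smul_eq_mul] at this
    exact (mul_eq_zero.1 this).resolve_right h4
  obtain ⟨r, hr, hball⟩ := Metric.eventually_nhds_iff_ball.1 hderiv
  have hconst : ∀ s ∈ Metric.ball (0 : ℂ) r, c s = 0 := by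
    intro s hs
    rw [← hc0]
    refine Metric.isOpen_ball.is_const_of_deriv_eq_zero (convex_ball _ _).isPreconnected
      (fun t ht => (hball t ht).1.differentiableWithinAt) (fun t ht => (hball t ht).2.1) hs
      (Metric.mem_ball_self hr)
  have hP : linePoly f p x = 0 := by
    refine Polynomial.eq_zero_of_infinite_isRoot _ (Set.Infinite.mono (s := Metric.ball (0 : ℂ) r)
      (fun t ht => ?_) (infinite_of_mem_nhds 0 (Metric.ball_mem_nhds 0 hr)))
    have := (hball t ht).2.2
    rw [hconst t ht] at this
    change Polynomial.eval t _ = 0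
    rw [eval_linePoly]
    simpa [F] using this
  rw [← eval_linePoly, hP, Polynomial.eval_zero]

/-- If the discriminant is finite, the tangent plane at a point outside the discriminant is
contained in the surface. -/
theorem eval_eq_zero_of_polyDeriv_eq_zero {f : MvPolynomial (Fin 4) ℂ} {d : ℕ}
    (hf : f.IsHomogeneous d) (hd : 2 ≤ d) (hS : (Disc d (zeroLocus f)).Finite)
    {p z : Fin 4 → ℂ} (hpG : Good f d p) (hp : MvPolynomial.eval p f = 0)
    (hz : polyDeriv f p z = 0) : MvPolynomial.eval z f = 0 := by
  obtain ⟨e, he0, he, hje, hev⟩ := exists_eventually_polyDeriv_eq_zero hf hd hS hpG hp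
  have hpp : polyDeriv f p p = 0 := by rw [polyDeriv_self hf, hp, mul_zero]
  have hjp := hpG.polyDeriv_jMap_ne_zero hf hp
  have hφ : (polyDeriv f p : (Fin 4 → ℂ) →ₗ[ℂ] ℂ) ≠ 0 := fun h => hjp (LinearMap.congr_fun h _)
  -- Chosen so that `x = z - c • p` also satisfies `φ (jMap x) = 0`, which puts `x` on the twistor
  -- line of the tangent plane; the conjugate appears because `jMap` is antilinear.
  set c := star (polyDeriv f p (jMap z) / polyDeriv f p (jMap p)) with hc
  set x := z - c • p with hxdef
  have hx : polyDeriv f p x = 0 := by rw [hxdef, map_sub, map_smul, hz, hpp, smul_zero, sub_zero]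
  have hjx : polyDeriv f p (jMap x) = 0 := by
    rw [hxdef, sub_eq_add_neg, ← neg_smul, jMap_add, jMap_smul, map_add, map_smul, star_neg, hc,
      star_star, smul_eq_mul, neg_mul, div_mul_cancel₀ _ hjp, add_neg_cancel]
  have hline : ∀ s : ℂ, MvPolynomial.eval (p + s • x) f = 0 := by
    refine eval_add_smul_eq_zero hp hjp (hev.mono fun w hw hw0 => ?_)
    by_cases hx0 : x = 0
    · rw [hx0, map_zero]
    · exact (apply_eq_zero_of_sameFibre (hw hw0).1 (hw hw0).2
        (sameFibre_of_apply_eq_zero hφ he0 hx0 he hje hx hjx)).1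
  have hzx : z = c • p + x := by rw [hxdef]; abel
  -- For `c = 0` the vector `z` is the point at infinity of the line, and its value is a top
  -- coefficient.
  by_cases hc0 : c = 0
  · have hP : linePoly f p x = 0 := Polynomial.funext fun t => by
      rw [eval_linePoly, hline, Polynomial.eval_zero]
    rw [hzx, hc0, zero_smul, zero_add, ← coeff_linePoly hf p x, hP, Polynomial.coeff_zero]
  · rw [hzx, show c • p + x = c • (p + c⁻¹ • x) by rw [smul_add, smul_inv_smul₀ hc0],
      eval_smul_of_isHomogeneous hf, hline, mul_zero]

/-! ### Planes as linear forms, and unions of planes through a twistor line -/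

theorem isPlane_iff {H : Set CP3} : IsPlane H ↔ ∃ φ : (Fin 4 → ℂ) →ₗ[ℂ] ℂ, φ ≠ 0 ∧
    ∀ z hz, Projectivization.mk ℂ z hz ∈ H ↔ φ z = 0 := by
  constructor
  · rintro ⟨l, hl0, hl, rfl⟩
    have key : ∀ z, MvPolynomial.eval z l = polyDeriv l 0 z := by
      intro z
      have h1 := hasDerivAt_eval_line l 0 z 0
      rw [zero_smul, add_zero] at h1
      have h2 : HasDerivAt (fun t : ℂ => MvPolynomial.eval (0 + t • z) l)
          (MvPolynomial.eval z l) 0 := by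
        have := (hasDerivAt_id (0 : ℂ)).mul_const (MvPolynomial.eval z l)
        rw [one_mul] at this
        refine this.congr_of_eventuallyEq (Eventually.of_forall fun t => ?_)
        simp only [zero_add]
        rw [eval_smul_of_isHomogeneous hl, pow_one, id]
      exact h2.unique h1
    refine ⟨polyDeriv l 0, fun h => hl0 (MvPolynomial.funext fun z => ?_), fun z hz => ?_⟩
    · rw [key, map_zero]
      exact LinearMap.congr_fun h z
    · rw [mk_mem_zeroLocus_iff hl, key]
      rfl
  · rintro ⟨φ, hφ, h⟩
    let M : Matrix Unit (Fin 4) ℂ := Matrix.of fun _ j => φ (Pi.single j 1)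
    have hM : ∀ z, MvPolynomial.eval z (M.toMvPolynomial ()) = φ z := by
      intro z
      rw [Matrix.toMvPolynomial_eval_eq_apply, LinearMap.pi_apply_eq_sum_univ φ z]
      simp only [Matrix.mulVec, dotProduct, M, Matrix.of_apply, smul_eq_mul, mul_comm]
      refine Finset.sum_congr rfl fun i _ => ?_
      congr 2
      funext k
      simp [Pi.single_apply, eq_comm]
    have hom := Matrix.toMvPolynomial_isHomogeneous M ()
    refine ⟨M.toMvPolynomial (), fun h0 => hφ (LinearMap.ext fun z => ?_), hom, ?_⟩
    · rw [← hM, h0, map_zero, LinearMap.zero_apply]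
    · ext p
      induction p using Projectivization.ind with
      | h z hz => rw [h, mk_mem_zeroLocus_iff hom, hM]

theorem encard_fibre_eq_top {X : Set CP3} {e : Fin 4 → ℂ} (he : e ≠ 0)
    (h : ∀ w hw, SameFibre e w → Projectivization.mk ℂ w hw ∈ X) :
    (twistorProj ⁻¹' {twistorProj (Projectivization.mk ℂ e he)} ∩ X).encard = ⊤ := by
  rw [Set.encard_eq_top_iff]
  refine (Set.infinite_range_of_injective (mk_add_smul_jMap_injective he)).mono ?_
  rintro _ ⟨t, rfl⟩
  exact ⟨(twistorProj_mk_eq_iff _ _).2 (sameFibre_add_smul_jMap e t),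
    h _ _ (sameFibre_add_smul_jMap e t)⟩

/-- The union of `d` distinct planes through a twistor line meets every other twistor line in
exactly `d` points. -/
theorem disc_eq_singleton {d : ℕ} (hd : 1 ≤ d) {X : Set CP3}
    (φ : Fin d → (Fin 4 → ℂ) →ₗ[ℂ] ℂ) (hφ : ∀ i, φ i ≠ 0)
    (hX : ∀ z hz, Projectivization.mk ℂ z hz ∈ X ↔ ∃ i, φ i z = 0)
    (hinj : ∀ i k, (∀ z, φ i z = 0 ↔ φ k z = 0) → i = k) {e : Fin 4 → ℂ} (he : e ≠ 0)
    (h : ∀ i, φ i e = 0) (hj : ∀ i, φ i (jMap e) = 0) :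
    Disc d X = {twistorProj (Projectivization.mk ℂ e he)} := by
  ext q
  rw [Set.mem_singleton_iff]
  constructor
  · intro hq
    by_contra hne
    apply hq
    obtain ⟨z, hz, rfl⟩ := exists_twistorProj_mk q
    have hez : ¬ SameFibre e z := fun hs => hne ((twistorProj_mk_eq_iff he hz).2 hs)
    have hpair : ∀ i, ¬ (φ i z = 0 ∧ φ i (jMap z) = 0) := fun i hi =>
      hez (sameFibre_of_apply_eq_zero (hφ i) he hz (h i) (hj i) hi.1 hi.2)
    -- The unique intersection point of the `i`-th plane with the fibre of `z`.
    let P : Fin d → Fin 4 → ℂ := fun i => φ i (jMap z) • z + (-φ i z) • jMap z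
    have hP : ∀ i, P i ≠ 0 := fun i hi => by
      have := span_jMap_eq_zero hz hi
      exact hpair i ⟨neg_eq_zero.1 this.2, this.1⟩
    have hφP : ∀ i k, φ i (P k) = φ k (jMap z) * φ i z - φ k z * φ i (jMap z) := fun i k => by
      simp only [P, map_add, map_smul, smul_eq_mul]
      ring
    have hrange : twistorProj ⁻¹' {twistorProj (Projectivization.mk ℂ z hz)} ∩ X =
        Set.range fun i => Projectivization.mk ℂ (P i) (hP i) := by
      ext p
      induction p using Projectivization.ind with
      | h w hw =>
      constructor
      · rintro ⟨h1, h2⟩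
        obtain ⟨u, v, huv⟩ := (twistorProj_mk_eq_iff hz hw).1 h1
        obtain ⟨i, hi⟩ := (hX w hw).1 h2
        refine ⟨i, ?_⟩
        rw [huv, map_add, map_smul, map_smul, smul_eq_mul, smul_eq_mul] at hi
        rw [eq_comm, Projectivization.mk_eq_mk_iff']
        by_cases ha : φ i (jMap z) = 0
        · have hb : φ i z ≠ 0 := fun hb => hpair i ⟨hb, ha⟩
          have hu : u = 0 := by simpa [ha, hb] using hi
          refine ⟨-(v / φ i z), ?_⟩
          simp only [P, ha, huv, hu, zero_smul, zero_add, smul_smul]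
          congr 1
          field_simp
        · refine ⟨u / φ i (jMap z), ?_⟩
          simp only [P, huv, smul_add, smul_smul]
          congr 2
          · field_simp
          · field_simp
            linear_combination -hi
      · rintro ⟨i, hi⟩
        rw [← hi]
        refine ⟨(twistorProj_mk_eq_iff _ _).2 ⟨_, _, rfl⟩, (hX _ _).2 ⟨i, ?_⟩⟩
        rw [hφP]
        ring
    rw [hrange, ← Set.image_univ, Function.Injective.encard_image]
    · simp
    intro i k hik
    obtain ⟨c, hc⟩ := (Projectivization.mk_eq_mk_iff' ℂ _ _ (hP i) (hP k)).1 hik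
    have h0 : φ k (jMap z) * φ i z - φ k z * φ i (jMap z) = 0 := by
      have h1 : φ k (P i) = 0 := by
        rw [← hc, map_smul, hφP]
        ring_nf
      rw [hφP] at h1
      linear_combination -h1
    have hvan : ∀ ψ : (Fin 4 → ℂ) →ₗ[ℂ] ℂ, ψ e = 0 → ψ (jMap e) = 0 → ψ z = 0 →
        ψ (jMap z) = 0 → ψ = 0 := fun ψ h1 h2 h3 h4 => by
      by_contra hψ
      exact hez (sameFibre_of_apply_eq_zero hψ he hz h1 h2 h3 h4)
    -- If the two planes meet the fibre in the same point, these combinations vanish on two disjoint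
    -- twistor lines, hence identically; the planes then coincide.
    have e1 : φ k z • φ i - φ i z • φ k = 0 := by
      apply hvan <;> simp [h, hj]
      · ring
      · linear_combination -h0
    have e2 : φ k (jMap z) • φ i - φ i (jMap z) • φ k = 0 := by
      apply hvan <;> simp [h, hj]
      · linear_combination h0
      · ring
    refine hinj i k fun w => ?_
    have f1 : φ k z * φ i w = φ i z * φ k w := by
      simpa [sub_eq_zero] using LinearMap.congr_fun e1 w
    have f2 : φ k (jMap z) * φ i w = φ i (jMap z) * φ k w := by
      simpa [sub_eq_zero] using LinearMap.congr_fun e2 w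
    have gi := hpair i
    have gk := hpair k
    constructor <;> intro hw
    · rw [hw, mul_zero] at f1 f2
      by_contra hne
      exact gi ⟨(mul_eq_zero.1 f1.symm).resolve_right hne,
        (mul_eq_zero.1 f2.symm).resolve_right hne⟩
    · rw [hw, mul_zero] at f1 f2
      by_contra hne
      exact gk ⟨(mul_eq_zero.1 f1).resolve_right hne, (mul_eq_zero.1 f2).resolve_right hne⟩
  · rintro rfl
    change Set.encard _ ≠ _
    rw [encard_fibre_eq_top he]
    · simp
    · rintro w hw ⟨u, v, rfl⟩
      exact (hX _ _).2 ⟨⟨0, hd⟩, by simp [h, hj]⟩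

/-! ### Planes contained in the surface -/

theorem polyDeriv_eq_zero_of_ker {f : MvPolynomial (Fin 4) ℂ} {φ : (Fin 4 → ℂ) →L[ℂ] ℂ}
    (h : ∀ z, φ z = 0 → MvPolynomial.eval z f = 0) {w x : Fin 4 → ℂ} (hw : φ w = 0)
    (hx : φ x = 0) : polyDeriv f w x = 0 := by
  have h1 := hasDerivAt_eval_line f w x 0
  rw [zero_smul, add_zero] at h1
  have h2 : (fun t : ℂ => MvPolynomial.eval (w + t • x) f) = fun _ => 0 := funext fun t =>
    h _ (by rw [map_add, map_smul, hw, hx, smul_zero, add_zero])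
  rw [h2] at h1
  exact h1.unique (hasDerivAt_const 0 0)

/-- A twistor line through a point of the intersection of two planes in `X` is tangent to `X`. -/
theorem not_good_of_two_planes {f : MvPolynomial (Fin 4) ℂ} {d : ℕ} (hf : f.IsHomogeneous d)
    {φ ψ : (Fin 4 → ℂ) →L[ℂ] ℂ} (hφ : ∀ z, φ z = 0 → MvPolynomial.eval z f = 0)
    (hψ : ∀ z, ψ z = 0 → MvPolynomial.eval z f = 0) {x : Fin 4 → ℂ} (hx : φ x = 0)
    (hx' : ψ x ≠ 0) {w : Fin 4 → ℂ} (hw : φ w = 0) (hw' : ψ w = 0) : ¬ Good f d w := by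
  intro hG
  apply hG.polyDeriv_jMap_ne_zero hf (hφ w hw)
  -- Splits `jMap w` into a vector of `ker ψ` and a multiple of `x`, a vector of `ker φ`; the
  -- derivative at `w` kills both.
  have e : jMap w = (jMap w - (ψ (jMap w) / ψ x) • x) + (ψ (jMap w) / ψ x) • x := by abel
  rw [e, map_add, map_smul, polyDeriv_eq_zero_of_ker hφ hw hx, smul_zero, add_zero]
  refine polyDeriv_eq_zero_of_ker hψ hw' ?_
  rw [map_sub, map_smul, smul_eq_mul, div_mul_cancel₀ _ hx', sub_self]

/-- Otherwise the intersection of the two planes is not a twistor line, and its points `w + t • e`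
lie in infinitely many fibres, none of them good. -/
theorem apply_jMap_eq_zero_of_two_planes {f : MvPolynomial (Fin 4) ℂ} {d : ℕ}
    (hf : f.IsHomogeneous d) (hS : (Disc d (zeroLocus f)).Finite)
    {φ ψ : (Fin 4 → ℂ) →L[ℂ] ℂ} (hφ : ∀ z, φ z = 0 → MvPolynomial.eval z f = 0)
    (hψ : ∀ z, ψ z = 0 → MvPolynomial.eval z f = 0) (hφ0 : φ ≠ 0) {x : Fin 4 → ℂ} (hx : φ x = 0)
    (hx' : ψ x ≠ 0) {e : Fin 4 → ℂ} (he0 : e ≠ 0) (he : φ e = 0) (hje : φ (jMap e) = 0)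
    (he' : ψ e = 0) : ψ (jMap e) = 0 := by
  by_contra hne
  obtain ⟨i, hi⟩ := Function.ne_iff.1 he0
  rw [Pi.zero_apply] at hi
  -- The condition `w i = 0`, with `e i ≠ 0`, makes `w` a second point of the intersection line,
  -- independent of `e`.
  have hker := LinearMap.ker_ne_bot_of_finrank_lt
    (f := (φ : (Fin 4 → ℂ) →ₗ[ℂ] ℂ).prod ((ψ : (Fin 4 → ℂ) →ₗ[ℂ] ℂ).prod (LinearMap.proj i)))
    (by simp)
  obtain ⟨w, hw, hw0⟩ := (Submodule.ne_bot_iff _).1 hker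
  have hw1 : φ w = 0 := congrArg Prod.fst hw
  have hw2 : ψ w = 0 := congrArg (fun a : ℂ × ℂ × ℂ => a.2.1) hw
  have hw3 : w i = 0 := congrArg (fun a : ℂ × ℂ × ℂ => a.2.2) hw
  have hφ0' : (φ : (Fin 4 → ℂ) →ₗ[ℂ] ℂ) ≠ 0 := fun h => hφ0 <|
    ContinuousLinearMap.ext fun z => LinearMap.congr_fun h z
  have hjw : φ (jMap w) ≠ 0 := by
    intro hjw
    obtain ⟨a, b, hab⟩ := sameFibre_of_apply_eq_zero hφ0' he0 hw0 he hje hw1 hjw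
    have hb : b = 0 := by
      rw [hab, map_add, map_smul, map_smul, he', smul_zero, zero_add, smul_eq_mul] at hw2
      exact (mul_eq_zero.1 hw2).resolve_right hne
    rw [hb, zero_smul, add_zero] at hab
    have ha : a = 0 := by
      rw [hab, Pi.smul_apply, smul_eq_mul] at hw3
      exact (mul_eq_zero.1 hw3).resolve_right hi
    exact hw0 (by rw [hab, ha, zero_smul])
  have hfin := finite_not_good hS (fun t : ℂ => w + t • e) (fun t ht => ?_) (fun t s hts => ?_)
  · refine Set.infinite_univ (α := ℂ) (hfin.subset fun t _ => ?_)
    exact not_good_of_two_planes hf hφ hψ hx hx'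
      (by rw [map_add, map_smul, hw1, he, smul_zero, add_zero])
      (by rw [map_add, map_smul, hw2, he', smul_zero, add_zero])
  · have h1 := congrFun ht i
    simp only [Pi.add_apply, Pi.smul_apply, hw3, smul_eq_mul, Pi.zero_apply, zero_add, mul_eq_zero,
      hi, or_false] at h1
    rw [h1, zero_smul, add_zero] at ht
    exact hw0 ht
  · obtain ⟨u, v, huv⟩ := hts
    have hv : v = 0 := by
      have h1 := congrArg φ huv
      simp only [jMap_add, jMap_smul, map_add, map_smul, hw1, he, hje, mul_zero, add_zero,
        zero_add, smul_eq_mul] at h1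
      exact (mul_eq_zero.1 h1.symm).resolve_right hjw
    rw [hv, zero_smul, add_zero] at huv
    have h1 := congrFun huv i
    simp only [Pi.add_apply, Pi.smul_apply, hw3, smul_eq_mul, zero_add, ← mul_assoc] at h1
    have hs : s = u * t := mul_right_cancel₀ hi h1
    have hu : (1 - u) • w = 0 := by
      rw [hs, smul_add, smul_smul] at huv
      rw [sub_smul, one_smul, sub_eq_zero]
      exact add_right_cancel huv
    have hu1 : u = 1 := (sub_eq_zero.1 ((smul_eq_zero.1 hu).resolve_right hw0)).symm
    rw [hs, hu1, one_mul]

/-- If the discriminant is finite, two planes contained in the surface contain the same twistor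
line. -/
theorem apply_eq_zero_of_two_planes {f : MvPolynomial (Fin 4) ℂ} {d : ℕ}
    (hf : f.IsHomogeneous d) (hS : (Disc d (zeroLocus f)).Finite)
    {φ ψ : (Fin 4 → ℂ) →L[ℂ] ℂ} (hφ : ∀ z, φ z = 0 → MvPolynomial.eval z f = 0)
    (hψ : ∀ z, ψ z = 0 → MvPolynomial.eval z f = 0) (hφ0 : φ ≠ 0) {x : Fin 4 → ℂ} (hx : φ x = 0)
    (hx' : ψ x ≠ 0) {e : Fin 4 → ℂ} (he0 : e ≠ 0) (he : φ e = 0) (hje : φ (jMap e) = 0) :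
    ψ e = 0 ∧ ψ (jMap e) = 0 := by
  by_contra hne
  -- The point where the twistor line of the first plane meets the second plane.
  set e' := ψ (jMap e) • e + (-ψ e) • jMap e with he'
  have he'0 : e' ≠ 0 := fun h => by
    have := span_jMap_eq_zero he0 h
    exact hne ⟨neg_eq_zero.1 this.2, this.1⟩
  have h1 : ψ e' = 0 := by
    rw [he', map_add, map_smul, map_smul, smul_eq_mul, smul_eq_mul]
    ring
  have hs : SameFibre e e' := ⟨_, _, rfl⟩
  obtain ⟨h2, h3⟩ := apply_eq_zero_of_sameFibre he hje hs
  have h4 := apply_jMap_eq_zero_of_two_planes hf hS hφ hψ hφ0 hx hx' he'0 h2 h3 h1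
  exact hne (apply_eq_zero_of_sameFibre h1 h4 (hs.symm he0 he'0))

/-- The points `[1, 0, t, 0]` lie in pairwise distinct fibres, so a finite discriminant misses some
of them. -/
theorem exists_good {f : MvPolynomial (Fin 4) ℂ} {d : ℕ} (hS : (Disc d (zeroLocus f)).Finite) :
    ∃ z, Good f d z := by
  by_contra! hne
  have hfin := finite_not_good hS (fun t : ℂ => ![1, 0, t, 0]) (fun t ht => ?_) (fun t s hts => ?_)
  · exact Set.infinite_univ (α := ℂ) (hfin.subset fun t _ => hne _)
  · simpa using congrFun ht 0
  · obtain ⟨u, v, huv⟩ := hts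
    have h0 := congrFun huv 0
    have h2 := congrFun huv 2
    simp [jMap] at h0 h2
    rw [h2, ← h0, one_mul]

/-- A zero of `f` lies on one of `d` distinct planes contained in `{f = 0}`, all of which contain
a common twistor line. -/
theorem exists_apply_eq_zero {f : MvPolynomial (Fin 4) ℂ} {d : ℕ} (hf : f.IsHomogeneous d)
    {φ : Fin d → (Fin 4 → ℂ) →L[ℂ] ℂ} (hφ : ∀ i z, φ i z = 0 → MvPolynomial.eval z f = 0)
    (hinj : ∀ i k, (∀ z, φ i z = 0 ↔ φ k z = 0) → i = k) {e y : Fin 4 → ℂ} (he0 : e ≠ 0)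
    (he : ∀ i, φ i e = 0 ∧ φ i (jMap e) = 0) (hy0 : y ≠ 0) (hey : ¬ SameFibre e y)
    (hy : linePoly f y (jMap y) ≠ 0) {z : Fin 4 → ℂ} (hz : MvPolynomial.eval z f = 0) :
    ∃ i, φ i z = 0 := by
  by_contra! hne
  -- The member through `z` of the pencil spanned by two of the planes; a direction `x` off all of
  -- these meets the planes at different parameters.
  let ψ : Fin d → Fin d → (Fin 4 → ℂ) →L[ℂ] ℂ := fun i k => φ i z • φ k - φ k z • φ i
  have hfin : (⋃ (i) (k) (_ : i ≠ k), {r : ℂ | ψ i k (y + r • jMap y) = 0}).Finite := by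
    refine Set.finite_iUnion fun i => Set.finite_iUnion fun k => Set.finite_iUnion fun hik =>
      Set.Subsingleton.finite fun r hr s hs => ?_
    by_contra hrs
    apply hik
    change ψ i k (y + r • jMap y) = 0 at hr
    change ψ i k (y + s • jMap y) = 0 at hs
    rw [map_add, map_smul, smul_eq_mul] at hr hs
    have hjy : ψ i k (jMap y) = 0 := by
      have : (r - s) * ψ i k (jMap y) = 0 := by linear_combination hr - hs
      exact (mul_eq_zero.1 this).resolve_left (sub_ne_zero.2 hrs)
    have hyy : ψ i k y = 0 := by rwa [hjy, mul_zero, add_zero] at hr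
    have h0 : (ψ i k : (Fin 4 → ℂ) →ₗ[ℂ] ℂ) = 0 := by
      by_contra h0
      exact hey (sameFibre_of_apply_eq_zero h0 he0 hy0 (by simp [ψ, he]) (by simp [ψ, he]) hyy hjy)
    refine hinj i k fun w => ?_
    have hw : φ i z * φ k w = φ k z * φ i w := by
      simpa [ψ, sub_eq_zero] using LinearMap.congr_fun h0 w
    constructor <;> intro h
    · rw [h, mul_zero] at hw
      exact (mul_eq_zero.1 hw).resolve_left (hne i)
    · rw [h, mul_zero] at hw
      exact (mul_eq_zero.1 hw.symm).resolve_left (hne k)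
  have hfin' : {r : ℂ | (linePoly f y (jMap y)).IsRoot r}.Finite :=
    Polynomial.finite_setOfPred_isRoot hy
  obtain ⟨r, hr⟩ := (hfin.union hfin').exists_notMem
  simp only [Set.mem_union, Set.mem_iUnion, not_or, not_exists] at hr
  obtain ⟨hr1, hr2⟩ := hr
  set x := y + r • jMap y with hx
  have hfx : MvPolynomial.eval x f ≠ 0 := fun h => hr2 (by
    change Polynomial.eval r _ = 0
    rwa [eval_linePoly])
  have hφx : ∀ i, φ i x ≠ 0 := fun i h => hfx (hφ i x h)
  -- The line `z + r • x` meets the surface at `r = 0` and at its intersections with the `d` planes: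
  -- `d + 1` distinct roots in degree at most `d`.
  let g : Option (Fin d) → ℂ := fun o => o.elim 0 fun i => -(φ i z / φ i x)
  have hg : Function.Injective g := by
    rintro (_ | i) (_ | k) h
    · rfl
    · simp [g, hne k, hφx k] at h
    · simp [g, hne i, hφx i] at h
    · by_contra hik
      refine hr1 i k (fun h' => hik (by rw [h'])) ?_
      change ψ i k x = 0
      simp only [g, Option.elim, neg_inj] at h
      rw [div_eq_div_iff (hφx i) (hφx k)] at h
      simp [ψ, h]
  have hzero : linePoly f z x = 0 := by
    refine Polynomial.eq_zero_of_natDegree_lt_card_of_eval_eq_zero _ hg ?_ ?_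
    · rintro (_ | i)
      · simp [g, eval_linePoly, hz]
      · rw [eval_linePoly]
        refine hφ i _ ?_
        simp [g, hφx i]
    · rw [Fintype.card_option, Fintype.card_fin]
      exact Nat.lt_succ_of_le (natDegree_linePoly_le hf z x)
  apply hfx
  rw [← coeff_linePoly hf z x, hzero, Polynomial.coeff_zero]

/-- If the discriminant is finite, the surface is a union of `d` distinct planes through a common
twistor line. -/
theorem exists_planes {f : MvPolynomial (Fin 4) ℂ} {d : ℕ} (hf : f.IsHomogeneous d)
    (hd : 2 ≤ d) (hS : (Disc d (zeroLocus f)).Finite) :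
    ∃ φ : Fin d → (Fin 4 → ℂ) →ₗ[ℂ] ℂ, (∀ i, φ i ≠ 0) ∧
      (∀ i k, (∀ z, φ i z = 0 ↔ φ k z = 0) → i = k) ∧
      (∀ z, MvPolynomial.eval z f = 0 ↔ ∃ i, φ i z = 0) ∧
      ∃ e, e ≠ 0 ∧ ∀ i, φ i e = 0 ∧ φ i (jMap e) = 0 := by
  obtain ⟨y, hy⟩ := exists_good hS
  obtain ⟨P, hP0, hyP, hfP, hP, -⟩ := hy.exists_roots hf
  have hG : ∀ i, Good f d (P i) := fun i => hy.of_sameFibre (hP0 i) (hyP i)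
  -- The planes are the tangent planes at the `d` points of one good fibre.
  let φ : Fin d → (Fin 4 → ℂ) →L[ℂ] ℂ := fun i => polyDeriv f (P i)
  have hj : ∀ i, φ i (jMap (P i)) ≠ 0 := fun i => (hG i).polyDeriv_jMap_ne_zero hf (hfP i)
  have hφ0 : ∀ i, φ i ≠ 0 := fun i h => hj i (by rw [h]; rfl)
  have hφ0' : ∀ i, (φ i : (Fin 4 → ℂ) →ₗ[ℂ] ℂ) ≠ 0 := fun i h => hj i (LinearMap.congr_fun h _)
  have hφP : ∀ i, φ i (P i) = 0 := fun i => by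
    change polyDeriv f (P i) (P i) = 0
    rw [polyDeriv_self hf, hfP, mul_zero]
  have hφf : ∀ i z, φ i z = 0 → MvPolynomial.eval z f = 0 := fun i z hz =>
    eval_eq_zero_of_polyDeriv_eq_zero hf hd hS (hG i) (hfP i) hz
  -- By transversality the `k`-th plane meets the fibre only at `P k`, which separates the planes.
  have hik : ∀ i k, φ k (P i) = 0 → k = i := by
    intro i k h
    obtain ⟨u, v, huv⟩ := ((hyP k).symm hy.1 (hP0 k)).trans (hP0 k) hy.1 (hP0 i) (hyP i)
    rw [huv, map_add, map_smul, map_smul, hφP, smul_zero, zero_add, smul_eq_mul] at h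
    rw [(mul_eq_zero.1 h).resolve_right (hj k), zero_smul, add_zero] at huv
    exact hP k i u huv
  have hinj : ∀ i k, (∀ z, φ i z = 0 ↔ φ k z = 0) → i = k := fun i k h =>
    (hik i k ((h _).1 (hφP i))).symm
  let i₀ : Fin d := ⟨0, by omega⟩
  obtain ⟨e, he0, he, hje⟩ :=
    exists_apply_eq_zero_and_apply_jMap_eq_zero (φ i₀ : (Fin 4 → ℂ) →ₗ[ℂ] ℂ)
  have hall : ∀ i, φ i e = 0 ∧ φ i (jMap e) = 0 := by
    intro i
    by_cases hi : i = i₀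
    · rw [hi]
      exact ⟨he, hje⟩
    · exact apply_eq_zero_of_two_planes hf hS (hφf i₀) (hφf i) (hφ0 i₀) (hφP i₀)
        (fun h => hi (hik i₀ i h)) he0 he hje
  have heG : ¬ Good f d e := not_good_of_tangent hf hd hS (hG i₀) (hfP i₀) he hje
  have hey : ¬ SameFibre e y := fun h => heG (hy.of_sameFibre he0 (h.symm he0 hy.1))
  refine ⟨fun i => φ i, hφ0', hinj, fun z => ⟨fun hz => ?_, ?_⟩, e, he0, hall⟩
  · exact exists_apply_eq_zero hf hφf hinj he0 hall hy.1 hey (hy.linePoly_ne_zero hf) hz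
  · rintro ⟨i, hi⟩
    exact hφf i z hi

theorem disc_eq_singleton_of_isPlane {d : ℕ} (hd : 1 ≤ d) {H : Fin d → Set CP3}
    (hinj : Function.Injective H) (hH : ∀ i, IsPlane (H i)) {L : Set CP3} (hL : IsTwistorLine L)
    (hLH : ∀ i, L ⊆ H i) : ∃ q, Disc d (⋃ i, H i) = {q} := by
  choose φ hφ0 hφ using fun i => isPlane_iff.1 (hH i)
  obtain ⟨q, rfl⟩ := hL
  obtain ⟨e, he, rfl⟩ := exists_twistorProj_mk q
  have hmem : ∀ i w, w ≠ 0 → SameFibre e w → φ i w = 0 := fun i w hw h =>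
    (hφ i w hw).1 (hLH i ((twistorProj_mk_eq_iff he hw).2 h))
  refine ⟨_, disc_eq_singleton hd φ hφ0 (fun z hz => ?_) (fun i k h => hinj ?_) he
    (fun i => hmem i e he ⟨1, 0, by simp⟩)
    (fun i => hmem i _ (jMap_ne_zero he) ⟨0, 1, by simp⟩)⟩
  · simp only [Set.mem_iUnion, hφ]
  · ext p
    induction p using Projectivization.ind with
    | h z hz => rw [hφ, hφ, h]

end Twistor

theorem proposition2p6 (d : ℕ) (hd : 1 ≤ d) (f : MvPolynomial (Fin 4) ℂ) (hf0 : f ≠ 0)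
    (hf : f.IsHomogeneous d) :
    ((Twistor.Disc d (Twistor.zeroLocus f)).Finite ↔
      d = 1 ∨
      (1 < d ∧ ∃ H : Fin d → Set Twistor.CP3, Function.Injective H ∧
        (∀ i, Twistor.IsPlane (H i)) ∧ Twistor.zeroLocus f = ⋃ i, H i ∧
        ∃ L : Set Twistor.CP3, Twistor.IsTwistorLine L ∧ ∀ i, L ⊆ H i)) ∧
    ((Twistor.Disc d (Twistor.zeroLocus f)).Finite →
      ∃ q : Twistor.HP1, Twistor.Disc d (Twistor.zeroLocus f) = {q}) := by
  have hforward : (Twistor.Disc d (Twistor.zeroLocus f)).Finite → d = 1 ∨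
      (1 < d ∧ ∃ H : Fin d → Set Twistor.CP3, Function.Injective H ∧
        (∀ i, Twistor.IsPlane (H i)) ∧ Twistor.zeroLocus f = ⋃ i, H i ∧
        ∃ L : Set Twistor.CP3, Twistor.IsTwistorLine L ∧ ∀ i, L ⊆ H i) := by
    intro hS
    rcases hd.eq_or_lt with h1 | h1
    · exact Or.inl h1.symm
    obtain ⟨φ, hφ0, hinj, hfφ, e, he0, he⟩ := Twistor.exists_planes hf h1 hS
    let H : Fin d → Set Twistor.CP3 := fun i => {p | φ i p.rep = 0}
    have hH : ∀ i z hz, Projectivization.mk ℂ z hz ∈ H i ↔ φ i z = 0 := by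
      intro i z hz
      obtain ⟨a, ha⟩ := Projectivization.exists_smul_eq_mk_rep ℂ z hz
      change φ i (Projectivization.mk ℂ z hz).rep = 0 ↔ _
      rw [← ha, Units.smul_def, map_smul, smul_eq_zero, or_iff_right a.ne_zero]
    refine Or.inr ⟨h1, H, fun i k h => hinj i k fun z => ?_,
      fun i => Twistor.isPlane_iff.2 ⟨φ i, hφ0 i, hH i⟩, ?_, _,
      ⟨Twistor.twistorProj (Projectivization.mk ℂ e he0), rfl⟩, ?_⟩
    · by_cases hz : z = 0
      · simp [hz]
      · rw [← hH i z hz, ← hH k z hz, h]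
    · ext p
      induction p using Projectivization.ind with
      | h z hz => rw [Twistor.mk_mem_zeroLocus_iff hf, hfφ, Set.mem_iUnion]; simp only [hH]
    · intro i p hp
      induction p using Projectivization.ind with
      | h z hz =>
        obtain ⟨u, v, rfl⟩ := (Twistor.twistorProj_mk_eq_iff he0 hz).1 hp
        rw [hH, map_add, map_smul, map_smul, (he i).1, (he i).2, smul_zero, smul_zero, add_zero]
  have hsingle : (d = 1 ∨
      (1 < d ∧ ∃ H : Fin d → Set Twistor.CP3, Function.Injective H ∧
        (∀ i, Twistor.IsPlane (H i)) ∧ Twistor.zeroLocus f = ⋃ i, H i ∧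
        ∃ L : Set Twistor.CP3, Twistor.IsTwistorLine L ∧ ∀ i, L ⊆ H i)) →
      ∃ q : Twistor.HP1, Twistor.Disc d (Twistor.zeroLocus f) = {q} := by
    rintro (rfl | ⟨h1, H, hinj, hH, hfH, L, hL, hLH⟩)
    -- Every plane contains a twistor line, so degree one is the case of a family with a single
    -- member.
    · have hplane : Twistor.IsPlane (Twistor.zeroLocus f) := ⟨f, hf0, hf, rfl⟩
      obtain ⟨φ, hφ0, hφ⟩ := Twistor.isPlane_iff.1 hplane
      obtain ⟨e, he0, he, hje⟩ := Twistor.exists_apply_eq_zero_and_apply_jMap_eq_zero φ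
      exact ⟨_, Twistor.disc_eq_singleton le_rfl (fun _ => φ) (fun _ => hφ0)
        (fun z hz => by simp [hφ]) (fun i k _ => Subsingleton.elim i k) he0 (fun _ => he)
        (fun _ => hje)⟩
    · rw [hfH]
      exact Twistor.disc_eq_singleton_of_isPlane hd hinj hH hL hLH
  refine ⟨⟨hforward, fun h => ?_⟩, fun h => hsingle (hforward h)⟩
  obtain ⟨q, hq⟩ := hsingle h
  rw [hq]
  exact Set.finite_singleton q
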